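/- **Definitions.** A *Petri net* $\langle P,T,F\rangle$ has finite disjoint sets $P=\{p_1,\dots,p_m\}$ of places and $T=\{t_1,\dots,t_n\}$ of transitions and a flow relation $F\subseteq(P\times T)\cup(T\times P)$. A *path* is a finite nonempty sequence of nodes in which consecutive nodes are joined by an arc. A path $e_0,\dots,e_k$ with $k\ge 1$ and without repeated nodes is a *cycle* if there is an arc from $e_k$ to $e_0$; the net is *acyclic* if it has no cycle. It is a *workflow net* if there are places $i$ without incoming arcs and $o$ without outgoing arcs such that every transition occurs in some path from $i$ to $o$. A *VAS associated with the net* has one variable $x_j$, ranging over the non-negative integers, for each place $p_j$. Its initial condition is $In_V(\underline x)=\bigwedge_{j=1}^m x_j\bowtie_j c_j$ with $c_j\in\mathbb N$ and $\bowtie_j\in\{=,\neq,>,\ge\}$. It has one transition formula $\tau^V_i(\underline x,\underline x')$ for each $t_i$, which requires $x_j\ge 1$ for all input places of $t_i$, subtracts one token from each input place, adds one token to each output place, and leaves the other variables unchanged. An *RBAC4BPEL system* with $n$ transitions has an underlying structure with four nonempty finite sorts, $User$, $Role$, $Permission$ and $Action$, each element of which is named by a constant, with relations $ua\subseteq User\times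 Role$ and $pa\subseteq Role\times Permission$ and a partial order $\succeq$ on $Role$; all of this is finite and explicitly given. Its only state variable is a predicate $xcd$ on $User\times Action$. Formulas are built from equality, $ua$, $pa$, $\succeq$ and $xcd$, with the constants as the only function symbols. The initial condition $In_R(xcd)$ has the form $\forall\underline w.\,\varphi(\underline w)$ with $\varphi$ quantifier-free. Each transition $\tau^R_i$ has the form $$\exists\underline u.\Bigl(\xi(\underline u,xcd)\wedge\forall x,y.\bigl(xcd'(x,y)\Leftrightarrow((x=u_j\wedge y=a)\vee xcd(x,y))\bigr)\Bigr)$$ with $\xi$ quantifier-free, $u_j$ a variable of sort $User$ in the tuple $\underline u$, and $a$ an action. The *VAS+RBAC4BPEL system* with these two associated systems has as states the pairs of a valuation of $\underline x$ and an interpretation of $xcd$, initial condition $In_V\wedge In_R$, and transitions $\tau_i^V\wedge\tau_i^R$ for $i=1,\dots,n$. A *goal* is a formula $G_V(\underline x)\wedge G_R(xcd)$, where $G_V$ is a first-order formula of linear integer arithmetic and $G_R$ is a Bernays–Schönfinkel–Ramsey formula, that is, $G_R=\exists\underline z\,\forall\underline w.\,\phi(\underline z,\underline w)$ with $\phi$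 quantifier-free. The *goal reachability problem* asks whether there is an $\ell\ge 0$ such that $$In(v_0)\wedge\bigwedge_{i=0}^{\ell-1}\tau(v_i,v_{i+1})\wedge G(v_\ell),\qquad \tau=\bigvee_{i=1}^n(\tau_i^V\wedge\tau_i^R),$$ is satisfiable in the underlying structure (the integers together with the policy structure). **Theorem.** The goal reachability problem is decidable for VAS+RBAC4BPEL systems whose associated VAS is associated with an acyclic workflow net and whose RBAC4BPEL system has a finite, known set of users: there is one algorithm that, given any such system and any goal $G_V\wedge G_R$, decides whether the goal is reachable. -/

import Mathlib

namespace WebService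

/-! ### Two-level transition systems and goal reachability -/

/-- A two-level transition system with `n` transitions, given over its underlying structure:
`α` is the type of valuations of the WF (workflow) state variables, `β` the type of
interpretations of the PM (policy management) state variables, a state is a pair in `α × β`,
and the formulas `In`, `τ_1, …, τ_n` are given by the (sets of) states that satisfy them. -/
structure TwoLevelSystem (α β : Type) (n : ℕ) where
  /-- the states satisfying the initial condition -/
  init : α × β → Prop
  /-- the pairs (state, next state) satisfying the `i`-th transition formula -/
  trans : Fin n → α × β → α × β → Prop

/-- The goal `G` is reachable: for some `ℓ ≥ 0`, the formula
`In(v_0) ∧ ⋀_{i < ℓ} τ(v_i, v_{i+1}) ∧ G(v_ℓ)`, where `τ = ⋁_j τ_j`, is satisfiable in the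
underlying structure. -/
def TwoLevelSystem.GoalReachable {α β : Type} {n : ℕ} (T : TwoLevelSystem α β n)
    (G : α × β → Prop) : Prop :=
  ∃ ℓ : ℕ, ∃ v : Fin (ℓ + 1) → α × β,
    T.init (v 0) ∧
    (∀ i : Fin ℓ, ∃ j : Fin n, T.trans j (v i.castSucc) (v i.succ)) ∧
    G (v (Fin.last ℓ))

/-! ### Petri nets -/

/-- A Petri net with places `Fin m` and transitions `Fin n`; the flow relation is given by its
two parts in `P × T` and `T × P`. -/
structure PetriNet (m n : ℕ) where
  /-- the arcs from places to transitions -/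
  placeToTrans : Fin m → Fin n → Bool
  /-- the arcs from transitions to places -/
  transToPlace : Fin n → Fin m → Bool

namespace PetriNet

variable {m n : ℕ} (N : PetriNet m n)

/-- The nodes of the net: places and transitions. -/
abbrev Node (m n : ℕ) : Type := Fin m ⊕ Fin n

/-- There is an arc from the first node to the second. -/
def Arc : Node m n → Node m n → Prop
  | .inl p, .inr t => N.placeToTrans p t = true
  | .inr t, .inl p => N.transToPlace t p = true
  | .inl _, .inl _ => False
  | .inr _, .inr _ => False

/-- A path: a nonempty finite sequence of nodes, consecutive ones being joined by an arc. -/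
def IsPath (l : List (Node m n)) : Prop :=
  l ≠ [] ∧ l.IsChain N.Arc

/-- A cycle: a path `e_0, …, e_k`, `k ≥ 1`, in which no element occurs more than once, with an
arc from `e_k` to `e_0`. -/
def IsCycle (l : List (Node m n)) : Prop :=
  N.IsPath l ∧ 2 ≤ l.length ∧ l.Nodup ∧
    ∃ a ∈ l.head?, ∃ b ∈ l.getLast?, N.Arc b a

/-- A net is acyclic if none of its paths is a cycle. -/
def Acyclic : Prop :=
  ∀ l : List (Node m n), ¬ N.IsCycle l

/-- A workflow net: there are places `i`, `o` such that `i` has no incoming arc, `o` has no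
outgoing arc, and every transition occurs in some path from `i` to `o`. -/
def IsWorkflowNet : Prop :=
  ∃ i o : Fin m,
    (∀ t, N.transToPlace t i = false) ∧
    (∀ t, N.placeToTrans o t = false) ∧
    ∀ t : Fin n, ∃ l : List (Node m n),
      N.IsPath l ∧ l.head? = some (.inl i) ∧ l.getLast? = some (.inl o) ∧ Sum.inr t ∈ l

end PetriNet

/-! ### Vector addition systems -/

/-- The comparison symbols allowed in initial conditions. -/
inductive Cmp
  | eq | ne | gt | ge

/-- `x ⋈ c`. -/
def Cmp.Holds : Cmp → ℕ → ℕ → Prop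
  | .eq, x, c => x = c
  | .ne, x, c => x ≠ c
  | .gt, x, c => x > c
  | .ge, x, c => x ≥ c

/-- What a transition does to a variable: `x' = x + 1`, `x' = x - 1` or `x' = x`. -/
inductive Change
  | inc | dec | keep

/-- The change of a variable, as an equation over the integers. -/
def Change.Holds : Change → ℕ → ℕ → Prop
  | .inc, x, x' => (x' : ℤ) = x + 1
  | .dec, x, x' => (x' : ℤ) = x - 1
  | .keep, x, x' => (x' : ℤ) = x

/-- A transition of a vector addition system with variables `x_1, …, x_m`: the set of variables
that must be positive for the transition to be enabled, and the partition of the variables into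
those incremented, decremented, and left unchanged. -/
structure VASTransition (m : ℕ) where
  guard : Fin m → Bool
  change : Fin m → Change

/-- The transition formula; state variables range over the non-negative integers. -/
def VASTransition.Holds {m : ℕ} (τ : VASTransition m) (x x' : Fin m → ℕ) : Prop :=
  (∀ i, τ.guard i = true → 1 ≤ x i) ∧ ∀ i, (τ.change i).Holds (x i) (x' i)

/-- A vector addition system with `m` state variables and `n` transitions. The initial condition
is `⋀_i x_i ⋈_i c_i`. -/
structure VAS (m n : ℕ) where
  init : Fin m → Cmp × ℕ
  trans : Fin n → VASTransition m

/-- The initial condition of a vector addition system. -/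
def VAS.Init {m n : ℕ} (V : VAS m n) (x : Fin m → ℕ) : Prop :=
  ∀ i, (V.init i).1.Holds (x i) (V.init i).2

/-- The formula of the transition `t` of a net: enabled if there is a token in each input place,
it consumes a token from each input place and produces one in each output place. -/
def PetriNet.vasTransition {m n : ℕ} (N : PetriNet m n) (t : Fin n) : VASTransition m where
  guard p := N.placeToTrans p t
  change p :=
    match N.placeToTrans p t, N.transToPlace t p with
    | true, false => .dec
    | false, true => .inc
    | true, true => .keep
    | false, false => .keep

/-- The vector addition system is the one associated with the net (with some initial
condition). -/
def VAS.IsAssociatedWith {m n : ℕ} (V : VAS m n) (N : PetriNet m n) : Prop :=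
  ∀ t, V.trans t = N.vasTransition t

/-! ### RBAC4BPEL systems -/

/-- The sorts of the policy level. -/
inductive Srt
  | user | role | permission | action

/-- A structure of the policy level: the sort `s` is an enumerated datatype with `size s ≥ 1`
values, each of which is also a constant symbol; `ua`, `pa` are finite relations and `hier r r'`,
that is `r ≽ r'`, is a partial order. -/
structure RBACStructure where
  size : Srt → ℕ
  size_pos : ∀ s, 1 ≤ size s
  ua : Fin (size .user) → Fin (size .role) → Bool
  pa : Fin (size .role) → Fin (size .permission) → Bool
  hier : Fin (size .role) → Fin (size .role) → Bool
  hier_refl : ∀ r, hier r r = true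
  hier_trans : ∀ r₁ r₂ r₃, hier r₁ r₂ = true → hier r₂ r₃ = true → hier r₁ r₃ = true
  hier_antisymm : ∀ r₁ r₂, hier r₁ r₂ = true → hier r₂ r₁ = true → r₁ = r₂

/-- An interpretation of the state variable `xcd` ("executed"). -/
abbrev RBACStructure.Xcd (A : RBACStructure) : Type :=
  Fin (A.size .user) → Fin (A.size .action) → Prop

/-- A tuple of sorted variables is given, up to order, by the number `Γ s` of variables of each
sort `s`. A term of sort `s` is a variable or a constant (there are no other function symbols). -/
inductive PTerm (size Γ : Srt → ℕ) (s : Srt) : Type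
  | var (i : Fin (Γ s)) : PTerm size Γ s
  | const (c : Fin (size s)) : PTerm size Γ s

/-- Quantifier-free formulas of the policy level with variables from `Γ`. -/
inductive QFFormula (size Γ : Srt → ℕ) : Type
  | eq (s : Srt) (a b : PTerm size Γ s) : QFFormula size Γ
  | ua (u : PTerm size Γ .user) (r : PTerm size Γ .role) : QFFormula size Γ
  | pa (r : PTerm size Γ .role) (p : PTerm size Γ .permission) : QFFormula size Γ
  | hier (r r' : PTerm size Γ .role) : QFFormula size Γ
  | xcd (u : PTerm size Γ .user) (a : PTerm size Γ .action) : QFFormula size Γ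
  | not (φ : QFFormula size Γ) : QFFormula size Γ
  | and (φ ψ : QFFormula size Γ) : QFFormula size Γ
  | or (φ ψ : QFFormula size Γ) : QFFormula size Γ

/-- An assignment of values to the variables of `Γ`. -/
abbrev Assignment (size Γ : Srt → ℕ) : Type := ∀ s : Srt, Fin (Γ s) → Fin (size s)

/-- The value of a term. -/
def PTerm.eval {size Γ : Srt → ℕ} {s : Srt} (ρ : Assignment size Γ) :
    PTerm size Γ s → Fin (size s)
  | .var i => ρ s i
  | .const c => c

/-- Satisfaction of a quantifier-free formula. -/
def QFFormula.Holds (A : RBACStructure) {Γ : Srt → ℕ} (X : A.Xcd) (ρ : Assignment A.size Γ) :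
    QFFormula A.size Γ → Prop
  | .eq _ a b => a.eval ρ = b.eval ρ
  | .ua u r => A.ua (u.eval ρ) (r.eval ρ) = true
  | .pa r p => A.pa (r.eval ρ) (p.eval ρ) = true
  | .hier r r' => A.hier (r.eval ρ) (r'.eval ρ) = true
  | .xcd u a => X (u.eval ρ) (a.eval ρ)
  | .not φ => ¬ φ.Holds A X ρ
  | .and φ ψ => φ.Holds A X ρ ∧ ψ.Holds A X ρ
  | .or φ ψ => φ.Holds A X ρ ∨ ψ.Holds A X ρ

/-- A transition of an RBAC4BPEL system:
`∃ u. (ξ(u, xcd) ∧ ∀ x y. (xcd'(x, y) ↔ (x = u_j ∧ y = a) ∨ xcd(x, y)))`. -/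
structure RBACTransition (size : Srt → ℕ) where
  /-- the existentially quantified tuple `u` -/
  vars : Srt → ℕ
  /-- the guard `ξ` -/
  guard : QFFormula size vars
  /-- the variable `u_j` of sort user -/
  performer : Fin (vars .user)
  /-- the action `a` -/
  act : Fin (size .action)

/-- The transition formula. -/
def RBACTransition.Holds (A : RBACStructure) (τ : RBACTransition A.size) (X X' : A.Xcd) : Prop :=
  ∃ u : Assignment A.size τ.vars, τ.guard.Holds A X u ∧
    ∀ x y, X' x y ↔ ((x = u .user τ.performer ∧ y = τ.act) ∨ X x y)

/-- An RBAC4BPEL system with `n` transitions and initial condition `∀ w. φ(w)`. -/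
structure RBACSystem (n : ℕ) where
  str : RBACStructure
  /-- the universally quantified tuple `w` of the initial condition -/
  initVars : Srt → ℕ
  /-- the quantifier-free matrix `φ` of the initial condition -/
  initMatrix : QFFormula str.size initVars
  trans : Fin n → RBACTransition str.size

/-- The initial condition of an RBAC4BPEL system. -/
def RBACSystem.Init {n : ℕ} (R : RBACSystem n) (X : R.str.Xcd) : Prop :=
  ∀ w : Assignment R.str.size R.initVars, R.initMatrix.Holds R.str X w

/-! ### VAS+RBAC4BPEL systems -/

/-- A VAS+RBAC4BPEL system, given by its associated VAS and RBAC4BPEL system. -/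
structure VASRBACSystem (m n : ℕ) where
  vas : VAS m n
  rbac : RBACSystem n

/-- The two-level transition system with initial condition `In_V ∧ In_R` and transitions
`τ_i^V ∧ τ_i^R`. -/
def VASRBACSystem.toTwoLevel {m n : ℕ} (S : VASRBACSystem m n) :
    TwoLevelSystem (Fin m → ℕ) S.rbac.str.Xcd n where
  init v := S.vas.Init v.1 ∧ S.rbac.Init v.2
  trans i v v' := (S.vas.trans i).Holds v.1 v'.1 ∧ (S.rbac.trans i).Holds S.rbac.str v.2 v'.2

/-! ### Goals: formulas of linear arithmetic and BSR formulas -/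

/-- Terms of linear arithmetic with variables `x_0, …, x_{k-1}`. -/
inductive LATerm (k : ℕ) : Type
  | var (i : Fin k) : LATerm k
  | const (c : ℤ) : LATerm k
  | add (a b : LATerm k) : LATerm k
  | smul (c : ℤ) (a : LATerm k) : LATerm k

/-- The value of a term. -/
def LATerm.eval {k : ℕ} (x : Fin k → ℤ) : LATerm k → ℤ
  | .var i => x i
  | .const c => c
  | .add a b => a.eval x + b.eval x
  | .smul c a => c * a.eval x

/-- First-order formulas of linear integer arithmetic with free variables `x_0, …, x_{k-1}`.
A quantifier binds the variable `x_0` of its body, the others being shifted by one. -/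
inductive LAFormula : ℕ → Type
  | eq {k : ℕ} (a b : LATerm k) : LAFormula k
  | le {k : ℕ} (a b : LATerm k) : LAFormula k
  | not {k : ℕ} (φ : LAFormula k) : LAFormula k
  | and {k : ℕ} (φ ψ : LAFormula k) : LAFormula k
  | or {k : ℕ} (φ ψ : LAFormula k) : LAFormula k
  | all {k : ℕ} (φ : LAFormula (k + 1)) : LAFormula k
  | ex {k : ℕ} (φ : LAFormula (k + 1)) : LAFormula k

/-- Satisfaction in the structure of the integers. -/
def LAFormula.Holds : {k : ℕ} → LAFormula k → (Fin k → ℤ) → Prop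
  | _, .eq a b, x => a.eval x = b.eval x
  | _, .le a b, x => a.eval x ≤ b.eval x
  | _, .not φ, x => ¬ φ.Holds x
  | _, .and φ ψ, x => φ.Holds x ∧ ψ.Holds x
  | _, .or φ ψ, x => φ.Holds x ∨ ψ.Holds x
  | _, .all φ, x => ∀ y : ℤ, φ.Holds (Fin.cons y x)
  | _, .ex φ, x => ∃ y : ℤ, φ.Holds (Fin.cons y x)

/-- BSR formulas `∃ z ∀ w. φ(z, w)` of the policy level, with `φ` quantifier-free. -/
structure BSRFormula (size : Srt → ℕ) where
  exVars : Srt → ℕ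
  allVars : Srt → ℕ
  /-- of each sort, the variables of `z` come first, followed by those of `w` -/
  matrix : QFFormula size (fun s => exVars s + allVars s)

/-- Satisfaction of a BSR formula. -/
def BSRFormula.Holds (A : RBACStructure) (G : BSRFormula A.size) (X : A.Xcd) : Prop :=
  ∃ z : Assignment A.size G.exVars, ∀ w : Assignment A.size G.allVars,
    G.matrix.Holds A X (fun s => Fin.append (z s) (w s))

/-- The goal `G_V ∧ G_R`, as a set of states of the system. -/
def VASRBACSystem.goal {m n : ℕ} (S : VASRBACSystem m n) (GV : LAFormula m)
    (GR : BSRFormula S.rbac.str.size) (v : (Fin m → ℕ) × S.rbac.str.Xcd) : Prop :=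
  GV.Holds (fun i => (v.1 i : ℤ)) ∧ GR.Holds S.rbac.str v.2

/-! ### Gödel numbers

Systems and goals are finite syntactic objects; to speak about algorithms that take them as
inputs, they are written down as natural numbers: finite tables are listed, and every constructor
gets a tag. -/

/-- The code of a finite sequence of numbers. -/
def seqCode {n : ℕ} (f : Fin n → ℕ) : ℕ := Encodable.encode (List.ofFn f)

/-- The code of a node with the given tag and two children. -/
def nodeCode (tag a b : ℕ) : ℕ := Nat.pair tag (Nat.pair a b)

/-- The code of an integer. -/
def intCode (c : ℤ) : ℕ := Nat.pair c.toNat (-c).toNat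

def Cmp.code : Cmp → ℕ
  | .eq => 0
  | .ne => 1
  | .gt => 2
  | .ge => 3

def Change.code : Change → ℕ
  | .inc => 0
  | .dec => 1
  | .keep => 2

def Srt.code : Srt → ℕ
  | .user => 0
  | .role => 1
  | .permission => 2
  | .action => 3

def VASTransition.code {m : ℕ} (τ : VASTransition m) : ℕ :=
  Nat.pair (seqCode fun i => (τ.guard i).toNat) (seqCode fun i => (τ.change i).code)

/-- The number of variables and of transitions are part of the code. -/
def VAS.code {m n : ℕ} (V : VAS m n) : ℕ :=
  Nat.pair (Nat.pair m n)
    (Nat.pair (seqCode fun i => Nat.pair (V.init i).1.code (V.init i).2)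
      (seqCode fun t => (V.trans t).code))

/-- The code of a family of numbers indexed by the sorts. -/
def sortCode (Γ : Srt → ℕ) : ℕ :=
  Nat.pair (Nat.pair (Γ .user) (Γ .role)) (Nat.pair (Γ .permission) (Γ .action))

/-- The code of a finite table of truth values. -/
def tableCode {a b : ℕ} (r : Fin a → Fin b → Bool) : ℕ :=
  seqCode fun i => seqCode fun j => (r i j).toNat

def RBACStructure.code (A : RBACStructure) : ℕ :=
  Nat.pair (sortCode A.size)
    (Nat.pair (tableCode A.ua) (Nat.pair (tableCode A.pa) (tableCode A.hier)))

def PTerm.code {size Γ : Srt → ℕ} {s : Srt} : PTerm size Γ s → ℕ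
  | .var i => Nat.pair 0 i
  | .const c => Nat.pair 1 c

def QFFormula.code {size Γ : Srt → ℕ} : QFFormula size Γ → ℕ
  | .eq s a b => nodeCode 0 s.code (Nat.pair a.code b.code)
  | .ua u r => nodeCode 1 u.code r.code
  | .pa r p => nodeCode 2 r.code p.code
  | .hier r r' => nodeCode 3 r.code r'.code
  | .xcd u a => nodeCode 4 u.code a.code
  | .not φ => nodeCode 5 φ.code 0
  | .and φ ψ => nodeCode 6 φ.code ψ.code
  | .or φ ψ => nodeCode 7 φ.code ψ.code

def RBACTransition.code {size : Srt → ℕ} (τ : RBACTransition size) : ℕ :=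
  Nat.pair (Nat.pair (sortCode τ.vars) τ.guard.code) (Nat.pair τ.performer τ.act)

def RBACSystem.code {n : ℕ} (R : RBACSystem n) : ℕ :=
  Nat.pair R.str.code
    (Nat.pair (Nat.pair (sortCode R.initVars) R.initMatrix.code)
      (seqCode fun t => (R.trans t).code))

def LATerm.code {k : ℕ} : LATerm k → ℕ
  | .var i => nodeCode 0 i 0
  | .const c => nodeCode 1 (intCode c) 0
  | .add a b => nodeCode 2 a.code b.code
  | .smul c a => nodeCode 3 (intCode c) a.code

def LAFormula.code : {k : ℕ} → LAFormula k → ℕ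
  | _, .eq a b => nodeCode 0 a.code b.code
  | _, .le a b => nodeCode 1 a.code b.code
  | _, .not φ => nodeCode 2 φ.code 0
  | _, .and φ ψ => nodeCode 3 φ.code ψ.code
  | _, .or φ ψ => nodeCode 4 φ.code ψ.code
  | _, .all φ => nodeCode 5 φ.code 0
  | _, .ex φ => nodeCode 6 φ.code 0

def BSRFormula.code {size : Srt → ℕ} (G : BSRFormula size) : ℕ :=
  Nat.pair (Nat.pair (sortCode G.exVars) (sortCode G.allVars)) G.matrix.code

/-- The code of an instance of the goal reachability problem: a system and a goal
`G_V ∧ G_R`. -/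
def VASRBACSystem.instanceCode {m n : ℕ} (S : VASRBACSystem m n) (GV : LAFormula m)
    (GR : BSRFormula S.rbac.str.size) : ℕ :=
  Nat.pair (Nat.pair S.vas.code S.rbac.code) (Nat.pair GV.code GR.code)

end WebService

/-! Users and actions are finitely many, so `xcd` is a subset of a finite set, and transitions only
add pairs to it. If there are `d` pairs, a run changes `xcd` at most `d` times: it consists of at
most `d + 1` blocks with constant `xcd`, separated by single changing transitions. Within a block
the policy guards do not vary. In an acyclic net the order of firings is no obstacle either: if the
state equation `x' = x + ∑ effect t * c t` holds between two markings, the firings counted by `c`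
can be ordered so that each is enabled (`PetriNet.Acyclic.fire`). A block is therefore just a vector
of firing counts, and reachability becomes a statement of Presburger arithmetic.

That statement is decided by a back-and-forth argument rather than by eliminating quantifiers.
Tuples are compared by `FormEquiv N`: same linear inequalities with coefficients up to `N`, same
residues modulo `N!`. If two tuples are equivalent to precision `gap N`, any new entry of the first
is matched by a new entry of the second, of computably bounded size, with precision `N` left
(`FormEquiv.extend`). Hence sufficiently equivalent tuples satisfy the same formulas of linear
arithmetic, and quantifiers may be bounded (`LAFormula.holds_iff`, `LAFormula.exists_bounded`).
Applied to the initial marking and then to the firing counts of each block, the same extension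
property turns any run to the goal into one with a bounded initial marking and bounded length
(`PetriNet.Acyclic.exists_bounded_run_of_init`). Precisions are computed backwards from the goal,
one `blockLevel` per block; sizes are computed forwards with `blockGrowth`.

The algorithm searches all runs within the bound. The search is primitive recursive in the code of
the instance: finite functions are strings of digits, so all quantifiers become bounded numerical
ones, and formulas are evaluated by course-of-values recursion on their codes. -/

namespace WebService

open Finset

/-! ### Equivalence of integer tuples up to bounded linear forms and residues -/

section FormEquiv

variable {ι : Type*}

/-- Two tuples satisfy the same linear inequalities with coefficients bounded by `N`, and their
entries are congruent modulo `N!`. -/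
def FormEquiv (N : ℕ) (s : Finset ι) (x y : ι → ℤ) : Prop :=
  (∀ (a : ι → ℤ) (c : ℤ), (∀ i ∈ s, |a i| ≤ N) → |c| ≤ N →
    (∑ i ∈ s, a i * x i + c ≤ 0 ↔ ∑ i ∈ s, a i * y i + c ≤ 0)) ∧
  ∀ i ∈ s, (N.factorial : ℤ) ∣ x i - y i

theorem FormEquiv.refl (N : ℕ) (s : Finset ι) (x : ι → ℤ) : FormEquiv N s x x :=
  ⟨fun _ _ _ _ => Iff.rfl, fun i _ => by simp⟩

theorem FormEquiv.symm {N : ℕ} {s : Finset ι} {x y : ι → ℤ} (h : FormEquiv N s x y) :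
    FormEquiv N s y x :=
  ⟨fun a c ha hc => (h.1 a c ha hc).symm, fun i hi => by
    have := h.2 i hi
    rwa [← neg_sub, dvd_neg]⟩

theorem FormEquiv.mono {N N' : ℕ} (hN : N ≤ N') {s : Finset ι} {x y : ι → ℤ}
    (h : FormEquiv N' s x y) : FormEquiv N s x y := by
  have hN' : (N : ℤ) ≤ N' := by exact_mod_cast hN
  exact ⟨fun a c ha hc => h.1 a c (fun i hi => (ha i hi).trans hN') (hc.trans hN'),
    fun i hi => dvd_trans (by exact_mod_cast Nat.factorial_dvd_factorial hN) (h.2 i hi)⟩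

theorem FormEquiv.empty (N : ℕ) (x y : ι → ℤ) : FormEquiv N ∅ x y :=
  ⟨fun _ _ _ _ => by simp, fun i hi => by simp at hi⟩

theorem FormEquiv.congr {N : ℕ} {s : Finset ι} {x y x' y' : ι → ℤ} (h : FormEquiv N s x y)
    (hx : ∀ i ∈ s, x i = x' i) (hy : ∀ i ∈ s, y i = y' i) : FormEquiv N s x' y' := by
  refine ⟨fun a c ha hc => ?_, fun i hi => by rw [← hx i hi, ← hy i hi]; exact h.2 i hi⟩
  rw [← Finset.sum_congr rfl (fun i hi => by rw [hx i hi] : ∀ i ∈ s, a i * x i = a i * x' i),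
    ← Finset.sum_congr rfl (fun i hi => by rw [hy i hi] : ∀ i ∈ s, a i * y i = a i * y' i)]
  exact h.1 a c ha hc

/-- Affine images of equivalent tuples are equivalent. -/
theorem FormEquiv.affine {κ : Type*} {N N' Q R : ℕ} {s : Finset ι} {t : Finset κ} {z w : ι → ℤ}
    {x y : κ → ℤ} (A : κ → ι → ℤ) (b : κ → ℤ) (h : FormEquiv N' s z w)
    (hx : ∀ j ∈ t, x j = ∑ i ∈ s, A j i * z i + b j)
    (hy : ∀ j ∈ t, y j = ∑ i ∈ s, A j i * w i + b j)
    (hA : ∀ i ∈ s, ∑ j ∈ t, |A j i| ≤ Q) (hb : ∑ j ∈ t, |b j| ≤ R)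
    (hQ : N * Q ≤ N') (hR : N * R + N ≤ N') : FormEquiv N t x y := by
  -- A form in the images pulls back to a form in the arguments. Its coefficients are at most `N`
  -- times the column sums of `A`, its constant at most `N * R + N`.
  have key : ∀ (v : ι → ℤ) (a : κ → ℤ) (c : ℤ),
      ∑ j ∈ t, a j * (∑ i ∈ s, A j i * v i + b j) + c
        = ∑ i ∈ s, (∑ j ∈ t, a j * A j i) * v i + (∑ j ∈ t, a j * b j + c) := by
    intro v a c
    simp only [mul_add, Finset.sum_add_distrib, Finset.mul_sum, Finset.sum_mul]
    rw [Finset.sum_comm]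
    simp only [mul_assoc, add_assoc]
  have bound : ∀ (a f : κ → ℤ) (B : ℕ), (∀ j ∈ t, |a j| ≤ N) → ∑ j ∈ t, |f j| ≤ B →
      |∑ j ∈ t, a j * f j| ≤ (N * B : ℕ) := by
    intro a f B ha hf
    calc |∑ j ∈ t, a j * f j| ≤ ∑ j ∈ t, |a j * f j| := Finset.abs_sum_le_sum_abs _ _
      _ ≤ ∑ j ∈ t, N * |f j| := Finset.sum_le_sum fun j hj => by
          rw [abs_mul]; exact mul_le_mul_of_nonneg_right (ha j hj) (abs_nonneg _)
      _ = N * ∑ j ∈ t, |f j| := by rw [Finset.mul_sum]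
      _ ≤ (N * B : ℕ) := by push_cast; exact mul_le_mul_of_nonneg_left hf (by positivity)
  refine ⟨fun a c ha hc => ?_, fun j hj => ?_⟩
  · have ex : ∑ j ∈ t, a j * x j = ∑ j ∈ t, a j * (∑ i ∈ s, A j i * z i + b j) :=
      Finset.sum_congr rfl fun j hj => by rw [hx j hj]
    have ey : ∑ j ∈ t, a j * y j = ∑ j ∈ t, a j * (∑ i ∈ s, A j i * w i + b j) :=
      Finset.sum_congr rfl fun j hj => by rw [hy j hj]
    rw [ex, ey, key, key]
    refine h.1 _ _ (fun i hi => ?_) ?_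
    · exact (bound a (fun j => A j i) Q ha (hA i hi)).trans (by exact_mod_cast hQ)
    · have h1 := bound a b R ha hb
      have h2 : ((N * R : ℕ) : ℤ) + N ≤ N' := by exact_mod_cast hR
      exact (abs_add_le _ _).trans (by linarith)
  · rw [hx j hj, hy j hj, add_sub_add_right_eq_sub, ← Finset.sum_sub_distrib]
    refine Finset.dvd_sum fun i hi => ?_
    rw [← mul_sub]
    refine Dvd.dvd.mul_left (dvd_trans ?_ (h.2 i hi)) _
    have : N ≤ N' := by omega
    exact_mod_cast Nat.factorial_dvd_factorial this

/-- The precision needed to extend an equivalence of precision `N` by one entry. -/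
def gap (N : ℕ) : ℕ := 2 * ((N + 1) * N.factorial) + N.factorial * N.factorial

/-- A bound for the new entry, in terms of the precision and the sum of the old entries. -/
def entryBound (N σ : ℕ) : ℕ := (N + 1) * N.factorial * (σ + 1) + N.factorial * N.factorial

theorem le_gap (N : ℕ) : 2 * N ≤ gap N := by
  have := Nat.factorial_pos N
  unfold gap; nlinarith

theorem entryBound_mono {N N' σ σ' : ℕ} (h : N ≤ N') (h' : σ ≤ σ') :
    entryBound N σ ≤ entryBound N' σ' := by
  have := Nat.factorial_le h
  unfold entryBound; gcongr

/-- The square is needed because `N! * u`, not `u`, is compared with forms: congruence modulo `N!`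
of the new entries requires congruence of the form values modulo `N! * N!`. -/
theorem factorial_sq_dvd_gap (N : ℕ) :
    ((N.factorial : ℤ) * N.factorial) ∣ ((gap N).factorial : ℤ) := by
  have h := Nat.factorial_pos N
  exact_mod_cast Nat.dvd_factorial (Nat.mul_pos h h) (by unfold gap; omega)

/-- The forms compared with a multiple of the new entry. -/
def IsBoundForm (K : ℕ) (s : Finset ι) (f : (ι → ℤ) × ℤ) : Prop :=
  (∀ i ∈ s, |f.1 i| ≤ K) ∧ |f.2| ≤ K

/-- The value of an affine form. -/
def formVal (s : Finset ι) (f : (ι → ℤ) × ℤ) (x : ι → ℤ) : ℤ := ∑ i ∈ s, f.1 i * x i + f.2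

theorem FormEquiv.formVal_le {K L : ℕ} {D : ℤ} {s : Finset ι} {x y : ι → ℤ} {f g : (ι → ℤ) × ℤ}
    (h : FormEquiv L s x y) (hf : IsBoundForm K s f) (hg : IsBoundForm K s g)
    (hL : 2 * K + |D| ≤ L) :
    formVal s f x + D ≤ formVal s g x ↔ formVal s f y + D ≤ formVal s g y := by
  have e : ∀ v : ι → ℤ, formVal s f v + D ≤ formVal s g v ↔
      ∑ i ∈ s, (f.1 i - g.1 i) * v i + (f.2 - g.2 + D) ≤ 0 := by
    intro v
    simp only [formVal, sub_mul, Finset.sum_sub_distrib]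
    constructor <;> intro h <;> linarith
  rw [e, e]
  refine h.1 _ _ (fun i hi => ?_) ?_
  · have := abs_sub (f.1 i) (g.1 i)
    have := hf.1 i hi
    have := hg.1 i hi
    have := abs_nonneg D
    linarith
  · have := abs_sub f.2 g.2
    have := abs_add_le (f.2 - g.2) D
    have := hf.2
    have := hg.2
    linarith

/-- The number `N! * u` cuts the set of values at `x` of the bounded forms, and `N! * v` has to make
the same cut at `y`. It is placed relative to the form whose value is nearest below `N! * u`, or to
the least form if none lies below, with the distance reduced modulo `N! * N!`. The reduction keeps
`v` bounded and costs only a constant of size at most `N! * N!` when two forms are compared. -/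
theorem FormEquiv.exists_cut {N : ℕ} {s : Finset ι} {x y : ι → ℤ}
    (h : FormEquiv (gap N) s x y) (u : ℤ) :
    ∃ v : ℤ, |v| ≤ entryBound N (∑ i ∈ s, (y i).natAbs) ∧ (N.factorial : ℤ) ∣ u - v ∧
      ∀ f, IsBoundForm ((N + 1) * N.factorial) s f →
        ((N.factorial : ℤ) * u ≤ formVal s f x ↔ (N.factorial : ℤ) * v ≤ formVal s f y) := by
  set K : ℕ := (N + 1) * N.factorial with hK
  set M : ℤ := (N.factorial : ℤ) with hM
  have hM1 : 1 ≤ M := by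
    have := Nat.factorial_pos N
    rw [hM]; exact_mod_cast this
  have hMM : 1 ≤ M * M := by nlinarith
  have hgap : ((gap N : ℕ) : ℤ) = 2 * K + M * M := by simp [gap, hK, hM]
  have hdvd : ∀ f : (ι → ℤ) × ℤ, M * M ∣ formVal s f x - formVal s f y := by
    intro f
    have : formVal s f x - formVal s f y = ∑ i ∈ s, f.1 i * (x i - y i) := by
      simp only [formVal, mul_sub, Finset.sum_sub_distrib]; ring
    rw [this]
    exact Finset.dvd_sum fun i hi =>
      Dvd.dvd.mul_left ((factorial_sq_dvd_gap N).trans (h.2 i hi)) _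
  have hval : ∀ f, IsBoundForm K s f → |formVal s f y| ≤ K * ((∑ i ∈ s, (y i).natAbs : ℕ) + 1) := by
    intro f hf
    calc |formVal s f y| ≤ |∑ i ∈ s, f.1 i * y i| + |f.2| := abs_add_le _ _
      _ ≤ ∑ i ∈ s, |f.1 i * y i| + |f.2| := by gcongr; exact Finset.abs_sum_le_sum_abs _ _
      _ ≤ ∑ i ∈ s, K * |y i| + K := by
          gcongr with i hi
          · rw [abs_mul]; gcongr; exact hf.1 i hi
          · exact hf.2
      _ = K * ((∑ i ∈ s, (y i).natAbs : ℕ) + 1) := by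
          push_cast [Int.natCast_natAbs]; rw [← Finset.mul_sum]; ring
  have fin : ∀ (v δ : ℤ) (f), IsBoundForm K s f → M * v = formVal s f y + δ → |δ| ≤ M * M →
      |v| ≤ entryBound N (∑ i ∈ s, (y i).natAbs) := by
    intro v δ f hf hv hδ
    have h1 := hval f hf
    have h2 : |v| ≤ |M * v| := by
      rw [abs_mul, abs_of_pos (show 0 < M by linarith)]
      nlinarith [abs_nonneg v]
    have h3 := abs_add_le (formVal s f y) δ
    rw [← hv] at h3
    have h4 : ((entryBound N (∑ i ∈ s, (y i).natAbs) : ℕ) : ℤ)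
        = K * ((∑ i ∈ s, (y i).natAbs : ℕ) + 1) + M * M := by
      simp [entryBound, hK, hM]
    rw [h4]; linarith
  by_cases hlow : ∃ z : ℤ, z < M * u ∧ ∃ f, IsBoundForm K s f ∧ z = formVal s f x
  · obtain ⟨z, ⟨hz, f₀, hf₀, rfl⟩, hmax⟩ := Int.exists_greatest_of_bdd
      (P := fun z => z < M * u ∧ ∃ f, IsBoundForm K s f ∧ z = formVal s f x)
      ⟨M * u, fun z hz => hz.1.le⟩ hlow
    set δ := M * u - formVal s f₀ x with hδ
    -- Shifting by one puts the residue into `[1, M * M]`, so that `M * v` stays strictly above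
    -- `f₀`.
    set δ' := (δ - 1) % (M * M) + 1 with hδ'
    have h0 : 0 ≤ (δ - 1) % (M * M) := Int.emod_nonneg _ (by linarith)
    have h1 : (δ - 1) % (M * M) < M * M := Int.emod_lt_of_pos _ (by linarith)
    have h2 : δ' ≤ δ := by
      have hdiv : 0 ≤ (δ - 1) / (M * M) := Int.ediv_nonneg (by omega) (by linarith)
      have := Int.mul_ediv_add_emod (δ - 1) (M * M)
      nlinarith
    obtain ⟨q, hq⟩ : M * M ∣ δ - δ' := ⟨(δ - 1) / (M * M), by
      have := Int.mul_ediv_add_emod (δ - 1) (M * M)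
      rw [hδ']; linarith⟩
    obtain ⟨q', hq'⟩ := hdvd f₀
    have hv : M * (u - M * (q + q')) = formVal s f₀ y + δ' := by linarith
    have habs : |δ'| ≤ M * M := by rw [abs_of_nonneg (by omega)]; omega
    refine ⟨u - M * (q + q'), fin _ δ' f₀ hf₀ hv habs, ⟨q + q', by ring⟩, fun f hf => ?_⟩
    rw [hv]
    constructor
    · intro hu
      exact (h.formVal_le hf₀ hf (by rw [hgap]; linarith)).1 (by linarith)
    -- A form with value below `M * u` is at most `f₀` at `x` by maximality, hence also at `y`,
    -- where `f₀` is strictly below `M * v`.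
    · intro hu
      by_contra hlt
      have h3 := hmax (formVal s f x) ⟨not_le.1 hlt, f, hf, rfl⟩
      have h4 := (h.formVal_le (D := 0) hf hf₀ (by rw [hgap]; simp; nlinarith)).1 (by linarith)
      omega
  -- No form lies below `M * u`, so it is enough to put `M * v` at or below the least form at `y`,
  -- which is the one least at `x`.
  · push Not at hlow
    have hle : ∀ f, IsBoundForm K s f → M * u ≤ formVal s f x := by
      intro f hf
      by_contra hlt
      exact hlow _ (not_le.1 hlt) f hf rfl
    obtain ⟨z, ⟨f₁, hf₁, rfl⟩, hmin⟩ := Int.exists_least_of_bdd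
      (P := fun z => ∃ f, IsBoundForm K s f ∧ z = formVal s f x)
      ⟨M * u, by rintro z ⟨f, hf, rfl⟩; exact hle f hf⟩
      ⟨_, 0, ⟨by simp, by simp⟩, rfl⟩
    set δ := formVal s f₁ x - M * u with hδ
    have h0 : 0 ≤ δ % (M * M) := Int.emod_nonneg _ (by linarith)
    have h1 : δ % (M * M) < M * M := Int.emod_lt_of_pos _ (by linarith)
    have hq := Int.mul_ediv_add_emod δ (M * M)
    obtain ⟨q', hq'⟩ := hdvd f₁
    have hv : M * (u - M * (q' - δ / (M * M))) = formVal s f₁ y + -(δ % (M * M)) := by linarith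
    refine ⟨u - M * (q' - δ / (M * M)), fin _ _ f₁ hf₁ hv ?_, ⟨q' - δ / (M * M), by ring⟩, fun f hf => ?_⟩
    · rw [abs_neg, abs_of_nonneg h0]; exact h1.le
    · refine ⟨fun _ => ?_, fun _ => hle f hf⟩
      have h4 := (h.formVal_le (D := 0) hf₁ hf (by rw [hgap]; simp; nlinarith)).1
        (by linarith [hmin _ ⟨f, hf, rfl⟩])
      rw [hv]; linarith

variable [DecidableEq ι]

/-- A nonzero coefficient `a i` of the new entry divides `N!`. Multiplying the inequality by `N! /
|a i|` turns it into a comparison of `N!` times the new entry with a form in the old entries, which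
`exists_cut` preserves. -/
theorem FormEquiv.extend {N : ℕ} {s : Finset ι} {x y : ι → ℤ} {i : ι} (hi : i ∉ s)
    (h : FormEquiv (gap N) s x y) :
    ∃ v : ℤ, |v| ≤ entryBound N (∑ j ∈ s, (y j).natAbs) ∧
      FormEquiv N (insert i s) x (Function.update y i v) := by
  obtain ⟨v, hv, hdvd, hcut⟩ := h.exists_cut (x i)
  refine ⟨v, hv, fun a c ha hc => ?_, fun j hj => ?_⟩
  · have hy : ∑ j ∈ insert i s, a j * Function.update y i v j
        = a i * v + ∑ j ∈ s, a j * y j := by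
      rw [Finset.sum_insert hi, Function.update_self]
      congr 1
      refine Finset.sum_congr rfl fun j hj => ?_
      rw [Function.update_of_ne (by rintro rfl; exact hi hj)]
    rw [hy, Finset.sum_insert hi]
    have hs : ∀ j ∈ s, |a j| ≤ N := fun j hj => ha j (Finset.mem_insert_of_mem hj)
    have hai := ha i (Finset.mem_insert_self _ _)
    rcases eq_or_ne (a i) 0 with h0 | h0
    · simp only [h0, zero_mul, zero_add]
      exact (h.mono (by have := le_gap N; omega)).1 a c hs hc
    · obtain ⟨r, hr⟩ : (a i).natAbs ∣ N.factorial :=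
        Nat.dvd_factorial (Int.natAbs_pos.2 h0)
          (by have := Int.natCast_natAbs (a i); omega)
      have hr0 : 0 < r := by
        rcases Nat.eq_zero_or_pos r with rfl | h
        · simp at hr; exact absurd hr (Nat.factorial_ne_zero N)
        · exact h
      have hrM : r ≤ N.factorial := by
        rw [hr]; exact Nat.le_mul_of_pos_left _ (Int.natAbs_pos.2 h0)
      have hr' : (N.factorial : ℤ) = |a i| * r := by
        rw [hr]; push_cast [Int.natCast_natAbs]; rfl
      have hrz : (0 : ℤ) < r := by exact_mod_cast hr0
      have hrMz : (r : ℤ) ≤ N.factorial := by exact_mod_cast hrM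
      have hcoef : ∀ b : ℤ, |b| ≤ N + 1 → |r * b| ≤ ((N + 1) * N.factorial : ℕ) := by
        intro b hb
        rw [abs_mul, abs_of_pos hrz]
        push_cast
        rw [mul_comm]
        exact mul_le_mul hb hrMz hrz.le (by positivity)
      have hsum : ∀ (e : ℤ) (w : ι → ℤ), ∑ j ∈ s, r * (e * a j) * w j
          = r * (e * ∑ j ∈ s, a j * w j) := by
        intro e w
        simp only [Finset.mul_sum, mul_assoc]
      rcases lt_or_gt_of_ne h0 with hneg | hpos
      -- For negative `a i` the inequality bounds the entry from below, so it is the negation of an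
      -- upper bound with constant `c - 1`. This is why forms up to `(N + 1) * N!` are admitted.
      · have hc := hcut (fun j => r * (1 * a j), r * (c - 1)) ⟨fun j hj => hcoef _ (by
          rw [one_mul]; linarith [hs j hj]), hcoef _ (by
          have := abs_sub c 1
          simp at this; linarith)⟩
        simp only [formVal, hsum, hr', abs_of_neg hneg] at hc
        have e : ∀ u S : ℤ, a i * u + S + c ≤ 0 ↔
            ¬ (-a i * r * u ≤ r * (1 * S) + r * (c - 1)) := by
          intro u S
          have : -a i * r * u ≤ r * (1 * S) + r * (c - 1) ↔ -a i * u ≤ S + (c - 1) := by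
            rw [← mul_le_mul_iff_right₀ hrz (b := -a i * u)]
            constructor <;> intro h <;> linarith
          rw [this]; constructor
          · intro h; linarith
          · intro h
            have := not_le.1 h
            linarith [Int.add_one_le_iff.2 this]
        rw [e, e]
        exact not_congr hc
      · have hc := hcut (fun j => r * (-1 * a j), r * (-c)) ⟨fun j hj => hcoef _ (by
          rw [abs_mul]; simp; linarith [hs j hj]), hcoef _ (by rw [abs_neg]; linarith)⟩
        simp only [formVal, hsum, hr', abs_of_pos hpos] at hc
        have e : ∀ u S : ℤ, a i * u + S + c ≤ 0 ↔
            a i * r * u ≤ r * (-1 * S) + r * (-c) := by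
          intro u S
          rw [← mul_le_mul_iff_right₀ hrz (b := a i * u + S + c)]
          constructor <;> intro h <;> linarith
        rw [e, e]
        exact hc
  · rcases Finset.mem_insert.1 hj with rfl | hj'
    · rw [Function.update_self]; exact hdvd
    · rw [Function.update_of_ne (by rintro rfl; exact hi hj')]
      exact (h.mono (by have := le_gap N; omega)).2 j hj'

/-- One step of the bound for the sum of the entries. -/
def growth (K σ : ℕ) : ℕ := σ + entryBound K σ

theorem growth_mono (K : ℕ) : Monotone (growth K) := fun _ _ h =>
  add_le_add h (entryBound_mono le_rfl h)

theorem le_gap_iterate (k N : ℕ) : N ≤ gap^[k] N :=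
  Function.id_le_iterate_of_id_le (fun N => (Nat.le_mul_of_pos_left N two_pos).trans (le_gap N)) k N

/-- The entries in `t` are added one by one, each at the price of one `gap`. `K` dominates every
precision met on the way, so the single function `growth K` bounds each step. -/
theorem FormEquiv.extend_finset {N K : ℕ} {s t : Finset ι} {x y : ι → ℤ} (hd : Disjoint t s)
    (h : FormEquiv (gap^[#t] N) s x y) (hK : gap^[#t] N ≤ K) :
    ∃ y', (∀ j, j ∉ t → y' j = y j) ∧ FormEquiv N (t ∪ s) x y' ∧
      ∑ j ∈ t ∪ s, (y' j).natAbs ≤ (growth K)^[#t] (∑ j ∈ s, (y j).natAbs) := by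
  induction t using Finset.induction_on generalizing N with
  | empty => exact ⟨y, fun _ _ => rfl, by simpa using h, by simp⟩
  | insert i t hi ih =>
    rw [Finset.card_insert_of_notMem hi, Function.iterate_succ_apply] at h hK
    rw [Finset.disjoint_insert_left] at hd
    obtain ⟨y', hy', he, hb⟩ := ih hd.2 h hK
    have hi' : i ∉ t ∪ s := by simp [hi, hd.1]
    obtain ⟨v, hv, hv'⟩ := he.extend hi'
    refine ⟨Function.update y' i v, fun j hj => ?_, by rwa [Finset.insert_union], ?_⟩
    · rw [Finset.mem_insert, not_or] at hj
      rw [Function.update_of_ne hj.1, hy' j hj.2]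
    · rw [Finset.insert_union, Finset.sum_insert hi', Function.update_self,
        Finset.card_insert_of_notMem hi, Function.iterate_succ_apply']
      have h1 : ∑ j ∈ t ∪ s, (Function.update y' i v j).natAbs = ∑ j ∈ t ∪ s, (y' j).natAbs :=
        Finset.sum_congr rfl fun j hj => by
          rw [Function.update_of_ne (by rintro rfl; exact hi' hj)]
      have hNK : N ≤ K := (Nat.le_mul_of_pos_left N two_pos).trans <| (le_gap N).trans <|
        (le_gap_iterate _ _).trans hK
      rw [h1]
      calc v.natAbs + ∑ j ∈ t ∪ s, (y' j).natAbs
          ≤ entryBound N (∑ j ∈ t ∪ s, (y' j).natAbs) + ∑ j ∈ t ∪ s, (y' j).natAbs := by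
            gcongr; have := Int.natCast_natAbs v; omega
        _ ≤ growth K (∑ j ∈ t ∪ s, (y' j).natAbs) := by
            rw [add_comm]; exact add_le_add le_rfl (entryBound_mono hNK le_rfl)
        _ ≤ _ := growth_mono K hb

end FormEquiv

/-! ### Formulas of linear arithmetic under equivalence of tuples -/

theorem add_le_nodeCode (tag a b : ℕ) : tag + (a + b) ≤ nodeCode tag a b :=
  (Nat.add_le_add_left (Nat.add_le_pair a b) tag).trans (Nat.add_le_pair _ _)

theorem natAbs_le_intCode (c : ℤ) : c.natAbs ≤ intCode c := by
  have := Nat.add_le_pair c.toNat (-c).toNat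
  unfold intCode; omega

theorem FormEquiv.map {ι κ : Type*} {N : ℕ} {s : Finset ι} (f : ι ↪ κ) {x y : κ → ℤ}
    (h : FormEquiv N s (x ∘ f) (y ∘ f)) : FormEquiv N (s.map f) x y := by
  refine ⟨fun a c ha hc => ?_, fun i hi => ?_⟩
  · rw [Finset.sum_map, Finset.sum_map]
    exact h.1 (a ∘ f) c (fun i hi => ha _ (Finset.mem_map_of_mem f hi)) hc
  · obtain ⟨j, hj, rfl⟩ := Finset.mem_map.1 hi
    exact h.2 j hj

theorem FormEquiv.extend_cons {k N : ℕ} {x y : Fin k → ℤ} (h : FormEquiv (gap N) univ x y)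
    (u : ℤ) : ∃ v : ℤ, |v| ≤ entryBound N (∑ i, (y i).natAbs) ∧
      FormEquiv N univ (Fin.cons u x : Fin (k + 1) → ℤ) (Fin.cons v y) := by
  have h' : FormEquiv (gap N) (univ.map (Fin.succEmb k)) (Fin.cons u x : Fin (k + 1) → ℤ)
      (Fin.cons 0 y) := FormEquiv.map _ (h.congr (fun i _ => by simp) (fun i _ => by simp))
  obtain ⟨v, hv, he⟩ := h'.extend (i := 0) (by simp)
  refine ⟨v, by simpa [Finset.sum_map] using hv, ?_⟩
  rw [Fin.update_cons_zero] at he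
  convert he using 1
  rw [Fin.univ_succ, Finset.cons_eq_insert]
  rfl

/-- The precision up to which the truth of a formula with code `c` is determined. -/
def level (c : ℕ) : ℕ := gap^[c] 2

theorem level_succ (c : ℕ) : level (c + 1) = gap (level c) :=
  Function.iterate_succ_apply' gap c 2

theorem level_mono : Monotone level :=
  monotone_nat_of_le_succ fun c => by rw [level_succ]; have := le_gap (level c); omega

theorem two_pow_le_level (c : ℕ) : 2 ^ (c + 1) ≤ level c := by
  induction c with
  | zero => simp [level]
  | succ c ih => rw [level_succ, pow_succ]; have := le_gap (level c); omega

/-- The code bounds the coefficients because a node's code is at least the sum of its tag and its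
children: the tag of a sum leaves room for `2 ^ a + 2 ^ b ≤ 2 ^ (a + b + 1)`, and a factor satisfies
`|d| ≤ 2 ^ |d|`. -/
theorem LATerm.exists_form {k : ℕ} (t : LATerm k) : ∃ (a : Fin k → ℤ) (c : ℤ),
    (∀ i, |a i| ≤ 2 ^ t.code) ∧ |c| ≤ 2 ^ t.code ∧ ∀ x, t.eval x = ∑ i, a i * x i + c := by
  induction t with
  | var i =>
    refine ⟨Pi.single i 1, 0, fun j => ?_, by simp, fun x => ?_⟩
    · rcases eq_or_ne j i with rfl | h
      · simp [one_le_pow₀]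
      · simp [Pi.single_eq_of_ne h]
    · simp [LATerm.eval, Pi.single_apply]
  | const c =>
    refine ⟨0, c, by simp, ?_, fun x => by simp [LATerm.eval]⟩
    have h1 := natAbs_le_intCode c
    have h2 := add_le_nodeCode 1 (intCode c) 0
    have h3 : nodeCode 1 (intCode c) 0 < 2 ^ nodeCode 1 (intCode c) 0 := Nat.lt_two_pow_self
    rw [LATerm.code, ← Int.natCast_natAbs]
    have h4 : c.natAbs ≤ 2 ^ nodeCode 1 (intCode c) 0 := by omega
    exact_mod_cast h4
  | add s t hs ht =>
    obtain ⟨a, c, ha, hc, he⟩ := hs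
    obtain ⟨a', c', ha', hc', he'⟩ := ht
    have key : ((2 : ℤ) ^ s.code) + 2 ^ t.code ≤ 2 ^ (LATerm.add s t).code := by
      have h2 := add_le_nodeCode 2 s.code t.code
      have h3 : (2 : ℤ) ^ (s.code + t.code + 1) ≤ 2 ^ (LATerm.add s t).code :=
        pow_le_pow_right₀ (by norm_num) (by rw [LATerm.code]; omega)
      have h4 : (1 : ℤ) ≤ 2 ^ s.code := one_le_pow₀ (by norm_num)
      have h5 : (1 : ℤ) ≤ 2 ^ t.code := one_le_pow₀ (by norm_num)
      rw [pow_succ, pow_add] at h3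
      nlinarith
    refine ⟨a + a', c + c', fun i => ?_, ?_, fun x => ?_⟩
    · exact (abs_add_le _ _).trans (by linarith [ha i, ha' i])
    · exact (abs_add_le _ _).trans (by linarith)
    · simp only [LATerm.eval, he, he', Pi.add_apply, add_mul, Finset.sum_add_distrib]; ring
  | smul d t ht =>
    obtain ⟨a, c, ha, hc, he⟩ := ht
    have key : |d| * 2 ^ t.code ≤ 2 ^ (LATerm.smul d t).code := by
      have h1 := natAbs_le_intCode d
      have h2 := add_le_nodeCode 3 (intCode d) t.code
      have h3 : (2 : ℤ) ^ (d.natAbs + t.code) ≤ 2 ^ (LATerm.smul d t).code :=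
        pow_le_pow_right₀ (by norm_num) (by rw [LATerm.code]; omega)
      have h4 : (d.natAbs : ℤ) ≤ 2 ^ d.natAbs := by exact_mod_cast Nat.lt_two_pow_self.le
      rw [pow_add] at h3
      rw [← Int.natCast_natAbs]
      exact (mul_le_mul_of_nonneg_right h4 (by positivity)).trans h3
    refine ⟨fun i => d * a i, d * c, fun i => ?_, ?_, fun x => ?_⟩
    · rw [abs_mul]; exact (mul_le_mul_of_nonneg_left (ha i) (abs_nonneg d)).trans key
    · rw [abs_mul]; exact (mul_le_mul_of_nonneg_left hc (abs_nonneg d)).trans key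
    · simp only [LATerm.eval, he, mul_add, Finset.mul_sum, mul_assoc]

theorem LATerm.eval_le_iff {k N : ℕ} (s t : LATerm k) {x y : Fin k → ℤ}
    (h : FormEquiv N univ x y) (hN : 2 ^ (s.code + t.code + 1) ≤ N) :
    s.eval x ≤ t.eval x ↔ s.eval y ≤ t.eval y := by
  obtain ⟨a, c, ha, hc, he⟩ := s.exists_form
  obtain ⟨a', c', ha', hc', he'⟩ := t.exists_form
  have key : ((2 : ℤ) ^ s.code) + 2 ^ t.code ≤ N := by
    have h3 : ((2 ^ (s.code + t.code + 1) : ℕ) : ℤ) ≤ N := by exact_mod_cast hN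
    have h4 : (1 : ℤ) ≤ 2 ^ s.code := one_le_pow₀ (by norm_num)
    have h5 : (1 : ℤ) ≤ 2 ^ t.code := one_le_pow₀ (by norm_num)
    push_cast at h3
    rw [pow_succ, pow_add] at h3
    nlinarith
  have e : ∀ v : Fin k → ℤ, s.eval v ≤ t.eval v ↔ ∑ i, (a i - a' i) * v i + (c - c') ≤ 0 := by
    intro v
    simp only [he, he', sub_mul, Finset.sum_sub_distrib]
    constructor <;> intro h <;> linarith
  rw [e, e]
  refine h.1 _ _ (fun i _ => ?_) ?_
  · exact (abs_sub _ _).trans (by linarith [ha i, ha' i])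
  · exact (abs_sub _ _).trans (by linarith)

/-- Ehrenfeucht–Fraïssé argument. A quantifier uses one extension step, hence one `gap`, and the
body has a smaller code. Measuring by the code instead of the quantifier depth also makes the
precision exceed the coefficients of the atoms. -/
theorem LAFormula.holds_iff {k : ℕ} (φ : LAFormula k) {x y : Fin k → ℤ}
    (h : FormEquiv (level φ.code) univ x y) : φ.Holds x ↔ φ.Holds y := by
  induction φ with
  | eq s t =>
    have h1 := add_le_nodeCode 0 s.code t.code
    have h2 := two_pow_le_level (LAFormula.eq s t).code
    have h3 : 2 ^ (s.code + t.code + 1) ≤ level (LAFormula.eq s t).code :=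
      (Nat.pow_le_pow_right two_pos (by rw [LAFormula.code]; omega)).trans h2
    simp only [LAFormula.Holds, le_antisymm_iff]
    rw [LATerm.eval_le_iff s t h h3, LATerm.eval_le_iff t s h (by rwa [add_comm t.code])]
  | le s t =>
    have h1 := add_le_nodeCode 1 s.code t.code
    have h2 := two_pow_le_level (LAFormula.le s t).code
    exact LATerm.eval_le_iff s t h
      ((Nat.pow_le_pow_right two_pos (by rw [LAFormula.code]; omega)).trans h2)
  | not φ ih =>
    have := add_le_nodeCode 2 φ.code 0
    exact not_congr (ih (h.mono (level_mono (by rw [LAFormula.code]; omega))))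
  | and φ ψ ih ih' =>
    have := add_le_nodeCode 3 φ.code ψ.code
    exact and_congr (ih (h.mono (level_mono (by rw [LAFormula.code]; omega))))
      (ih' (h.mono (level_mono (by rw [LAFormula.code]; omega))))
  | or φ ψ ih ih' =>
    have := add_le_nodeCode 4 φ.code ψ.code
    exact or_congr (ih (h.mono (level_mono (by rw [LAFormula.code]; omega))))
      (ih' (h.mono (level_mono (by rw [LAFormula.code]; omega))))
  | all φ ih =>
    have := add_le_nodeCode 5 φ.code 0
    replace h : FormEquiv (gap (level φ.code)) univ x y := by
      rw [← level_succ]; exact h.mono (level_mono (by rw [LAFormula.code]; omega))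
    refine ⟨fun H u => ?_, fun H u => ?_⟩
    · obtain ⟨v, -, hv⟩ := h.symm.extend_cons u
      exact (ih hv).2 (H v)
    · obtain ⟨v, -, hv⟩ := h.extend_cons u
      exact (ih hv).2 (H v)
  | ex φ ih =>
    have := add_le_nodeCode 6 φ.code 0
    replace h : FormEquiv (gap (level φ.code)) univ x y := by
      rw [← level_succ]; exact h.mono (level_mono (by rw [LAFormula.code]; omega))
    refine ⟨fun ⟨u, H⟩ => ?_, fun ⟨u, H⟩ => ?_⟩
    · obtain ⟨v, -, hv⟩ := h.extend_cons u
      exact ⟨v, (ih hv).1 H⟩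
    · obtain ⟨v, -, hv⟩ := h.symm.extend_cons u
      exact ⟨v, (ih hv).1 H⟩

/-- A quantified integer can be replaced by one of bounded size. -/
theorem LAFormula.exists_bounded {k : ℕ} (φ : LAFormula (k + 1)) (x : Fin k → ℤ) (u : ℤ) :
    ∃ v : ℤ, |v| ≤ entryBound (level φ.code) (∑ i, (x i).natAbs) ∧
      (φ.Holds (Fin.cons u x) ↔ φ.Holds (Fin.cons v x)) := by
  obtain ⟨v, hv, he⟩ := (FormEquiv.refl (gap (level φ.code)) univ x).extend_cons u
  exact ⟨v, hv, φ.holds_iff he⟩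

/-! ### Acyclic nets -/

namespace PetriNet

variable {m n : ℕ} (N : PetriNet m n)

theorem not_arc_self (a : Node m n) : ¬ N.Arc a a := by
  cases a <;> simp [Arc]

variable {N}

/-- Every closed walk contains a cycle: between two occurrences of a repeated node lies a shorter
closed walk, and a walk with a single node would be a loop, which the bipartite arc relation
excludes. -/
theorem Acyclic.not_closed (hN : N.Acyclic) (l : List (Node m n)) (hl : l.IsChain N.Arc)
    (a b : Node m n) (ha : a ∈ l.head?) (hb : b ∈ l.getLast?) : ¬ N.Arc b a := by
  induction hk : l.length using Nat.strong_induction_on generalizing l a b with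
  | _ k ih =>
  subst hk
  intro hab
  by_cases hnd : l.Nodup
  · rcases l with _ | ⟨c, _ | ⟨d, l⟩⟩
    · simp at ha
    · simp only [List.head?_cons, List.getLast?_singleton, Option.mem_def,
        Option.some.injEq] at ha hb
      subst ha hb
      exact N.not_arc_self _ hab
    · exact hN _ ⟨⟨by simp, hl⟩, by simp, hnd, a, ha, b, hb, hab⟩
  · rw [← List.exists_duplicate_iff_not_nodup] at hnd
    obtain ⟨c, hc⟩ := hnd
    rw [List.duplicate_iff_sublist] at hc
    obtain ⟨l₁, r₁, rfl, h₁, h₂⟩ := List.cons_sublist_iff.1 hc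
    obtain ⟨s, t, rfl⟩ := List.append_of_mem h₁
    obtain ⟨p, q, rfl⟩ := List.append_of_mem (List.singleton_sublist.1 h₂)
    have hch : (((c :: (t ++ p)) ++ [c]) : List (Node m n)).IsChain N.Arc := by
      refine hl.infix ⟨s, q, ?_⟩
      simp
    rw [List.isChain_append] at hch
    obtain ⟨hc1, -, hc2⟩ := hch
    obtain ⟨d, hd⟩ : ∃ d, d ∈ (c :: (t ++ p)).getLast? :=
      ⟨_, List.getLast?_eq_getLast_of_ne_nil (by simp)⟩
    refine ih (c :: (t ++ p)).length ?_ (c :: (t ++ p)) hc1 c d (by simp) hd rfl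
      (hc2 d hd c (by simp))
    simp; omega

theorem Acyclic.not_transGen (hN : N.Acyclic) (a : Node m n) :
    ¬ Relation.TransGen N.Arc a a := by
  intro h
  obtain ⟨b, hab, hba⟩ := Relation.TransGen.tail'_iff.1 h
  obtain ⟨l, hl, hlast⟩ := List.exists_isChain_cons_of_relationReflTransGen hab
  exact hN.not_closed (a :: l) hl a b (by simp) (by
    rw [List.getLast?_eq_getLast_of_ne_nil (List.cons_ne_nil _ _), hlast]; rfl) hba

theorem Acyclic.wellFounded (hN : N.Acyclic) :
    WellFounded (Relation.TransGen N.Arc) :=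
  haveI : Std.Irrefl (Relation.TransGen N.Arc) := ⟨hN.not_transGen⟩
  Finite.wellFounded_of_trans_of_irrefl _

/-- A nonempty set of transitions has a member whose input places are not fed by the set. -/
theorem Acyclic.exists_first (hN : N.Acyclic) (S : Set (Fin n)) (hS : S.Nonempty) :
    ∃ t ∈ S, ∀ t' ∈ S, ∀ p, N.placeToTrans p t = true → N.transToPlace t' p = false := by
  obtain ⟨t₀, ht₀⟩ := hS
  obtain ⟨a, ⟨t, ht, rfl⟩, hmin⟩ := hN.wellFounded.has_min (Sum.inr '' S) ⟨_, t₀, ht₀, rfl⟩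
  refine ⟨t, ht, fun t' ht' p hp => ?_⟩
  by_contra hne
  rw [Bool.not_eq_false] at hne
  refine hmin (Sum.inr t') ⟨t', ht', rfl⟩ (Relation.TransGen.tail (.single ?_) ?_ (b := Sum.inl p))
  · exact hne
  · exact hp

variable (N) in
/-- The effect of a transition on a place. -/
def effect (t : Fin n) (p : Fin m) : ℤ :=
  (if N.transToPlace t p = true then 1 else 0) - (if N.placeToTrans p t = true then 1 else 0)

theorem abs_effect_le (t : Fin n) (p : Fin m) : |N.effect t p| ≤ 1 := by
  unfold effect; split_ifs <;> simp

theorem vasTransition_holds_iff (t : Fin n) (x x' : Fin m → ℕ) :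
    (N.vasTransition t).Holds x x' ↔
      (∀ p, N.placeToTrans p t = true → 1 ≤ x p) ∧ ∀ p, (x' p : ℤ) = x p + N.effect t p := by
  refine and_congr Iff.rfl (forall_congr' fun p => ?_)
  simp only [vasTransition, effect]
  generalize N.placeToTrans p t = a
  generalize N.transToPlace t p = b
  cases a <;> cases b <;> simp [Change.Holds, sub_eq_add_neg]

end PetriNet

/-! ### Runs and the replacement of blocks of firings -/

/-- Some state satisfying `G` is reached from `s` in exactly `ℓ` steps. -/
def StepsTo {σ : Type*} (r : σ → σ → Prop) (G : σ → Prop) : ℕ → σ → Prop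
  | 0, s => G s
  | ℓ + 1, s => ∃ s', r s s' ∧ StepsTo r G ℓ s'

theorem stepsTo_iff {σ : Type*} (r : σ → σ → Prop) (G : σ → Prop) (ℓ : ℕ) (s : σ) :
    StepsTo r G ℓ s ↔ ∃ v : ℕ → σ, v 0 = s ∧ (∀ i < ℓ, r (v i) (v (i + 1))) ∧ G (v ℓ) := by
  induction ℓ generalizing s with
  | zero =>
    exact ⟨fun h => ⟨fun _ => s, rfl, by simp, h⟩, fun ⟨v, h0, _, h⟩ => h0 ▸ h⟩
  | succ ℓ ih =>
    constructor
    · rintro ⟨s', hr, h⟩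
      obtain ⟨v, h0, hv, hG⟩ := (ih s').1 h
      refine ⟨fun i => Nat.casesOn i s v, rfl, fun i hi => ?_, hG⟩
      cases i with
      | zero => show r s (v 0); rwa [h0]
      | succ i => exact hv i (by omega)
    · rintro ⟨v, rfl, hv, hG⟩
      exact ⟨v 1, hv 0 (by omega), (ih _).2 ⟨fun i => v (i + 1), rfl,
        fun i hi => hv (i + 1) (by omega), hG⟩⟩

/-- With `k = 0` this makes new integer entries natural numbers, with `k = 1` it transfers
enabledness, and with `k = c, c + 1` the atoms of an initial condition. -/
theorem FormEquiv.le_iff {ι : Type*} {N : ℕ} {s : Finset ι} {x y : ι → ℤ}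
    (h : FormEquiv N s x y) {i : ι} (hi : i ∈ s) (hN : 1 ≤ N) {k : ℤ} (hk : |k| ≤ N) :
    k ≤ x i ↔ k ≤ y i := by
  classical
  have e : ∀ v : ι → ℤ, k ≤ v i ↔ ∑ j ∈ s, (if j = i then -1 else 0) * v j + k ≤ 0 := by
    intro v
    simp only [ite_mul, zero_mul, Finset.sum_ite_eq', if_pos hi]
    constructor <;> intro h <;> linarith
  rw [e, e]
  refine h.1 _ _ (fun j _ => ?_) hk
  have : (1 : ℤ) ≤ N := by exact_mod_cast hN
  split_ifs <;> simp [this]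

/-- The precision needed to replace a block of firings, if precision `M` is needed after it. -/
def blockLevel (m n M : ℕ) : ℕ := gap^[n] (M * (m + 1))

/-- A bound for the sum of the tokens and the number of steps after a block of firings. -/
def blockGrowth (m n K b : ℕ) : ℕ := (m + 2) * ((growth K)^[n] b + 1)

theorem le_blockLevel (m n M : ℕ) : M ≤ blockLevel m n M :=
  (Nat.le_mul_of_pos_right _ (Nat.succ_pos m)).trans (le_gap_iterate _ _)

theorem le_blockLevel_iterate (m n d M : ℕ) : M ≤ (blockLevel m n)^[d] M :=
  Function.id_le_iterate_of_id_le (le_blockLevel m n) d M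

theorem le_growth_iterate (K k b : ℕ) : b ≤ (growth K)^[k] b :=
  Function.id_le_iterate_of_id_le (fun σ => Nat.le_add_right σ _) k b

theorem add_le_blockGrowth (m : ℕ) {n K a b : ℕ} (ha : a ≤ (growth K)^[n] b) :
    a + 1 + b ≤ blockGrowth m n K b := by
  have h1 := le_growth_iterate K n b
  have h2 : 2 * ((growth K)^[n] b + 1) ≤ blockGrowth m n K b :=
    Nat.mul_le_mul_right _ (by omega)
  omega

namespace PetriNet

variable {m n : ℕ} {N : PetriNet m n}

/-- The firing counts are treated as `n` further entries beside the marking and are matched by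
bounded counts. The marking reached is affine in counts and marking, with coefficients at most one
in absolute value, whence the factor `m + 1` in `blockLevel`. The offset `e` is `0` for the marking
after the block and the effect of the next transition for the marking one step later. Unused
transitions stay unused, so no new policy guard has to be checked. -/
theorem exists_block {M K b : ℕ} (hM : 1 ≤ M) {x y : Fin m → ℕ} {c : Fin n → ℕ}
    (h : FormEquiv (blockLevel m n M) univ (fun p => (x p : ℤ)) (fun p => (y p : ℤ)))
    (hK : blockLevel m n M ≤ K) (hb : ∑ p, y p ≤ b) :
    ∃ c' : Fin n → ℕ, (∀ t, c t = 0 → c' t = 0) ∧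
      (∀ e : Fin m → ℤ, (∀ p, |e p| ≤ 1) → FormEquiv M univ
        (fun p => x p + ∑ t, N.effect t p * c t + e p)
        (fun p => y p + ∑ t, N.effect t p * c' t + e p)) ∧
      ∑ t, c' t + ∑ p, y p ≤ (growth K)^[n] b := by
  set z : Fin n ⊕ Fin m → ℤ := Sum.elim (fun t => (c t : ℤ)) (fun p => (x p : ℤ)) with hz
  -- The zeros at the transitions are placeholders for the counts to be found.
  set w : Fin n ⊕ Fin m → ℤ := Sum.elim (fun _ => 0) (fun p => (y p : ℤ)) with hw
  set s : Finset (Fin n ⊕ Fin m) := univ.map Function.Embedding.inr with hs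
  set t : Finset (Fin n ⊕ Fin m) := univ.map Function.Embedding.inl with ht
  have htn : #t = n := by simp [ht]
  have hts : Disjoint t s := by
    rw [Finset.disjoint_left]; simp [hs, ht]
  have huniv : t ∪ s = univ := by ext i; cases i <;> simp [hs, ht]
  obtain ⟨w', hw', he, hsum⟩ := FormEquiv.extend_finset (N := M * (m + 1)) (K := K) (x := z)
    (y := w) hts (by rw [htn]; exact FormEquiv.map _ h) (by rwa [htn])
  rw [huniv] at he hsum
  rw [htn] at hsum
  have hM' : 1 ≤ M * (m + 1) := Nat.mul_pos hM (Nat.succ_pos m)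
  have hnn : ∀ t, 0 ≤ w' (Sum.inl t) := fun t =>
    (he.le_iff (mem_univ (Sum.inl t)) hM' (by simp)).1 (by simp [hz])
  have hwy : ∀ p, w' (Sum.inr p) = y p := fun p => by rw [hw' _ (by simp [ht])]; simp [hw]
  have hcast : ∀ t, ((w' (Sum.inl t)).toNat : ℤ) = w' (Sum.inl t) := fun t =>
    Int.toNat_of_nonneg (hnn t)
  refine ⟨fun t => (w' (Sum.inl t)).toNat, fun t h0 => ?_, fun e hb => ?_, ?_⟩
  · have h1 : ¬ (1 : ℤ) ≤ z (Sum.inl t) := by simp [hz, h0]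
    rw [he.le_iff (mem_univ _) hM' (by rw [abs_one]; exact_mod_cast hM')] at h1
    show (w' (Sum.inl t)).toNat = 0
    omega
  · refine FormEquiv.affine (Q := m) (R := m)
      (fun p => Sum.elim (fun t => N.effect t p) (fun q => if q = p then 1 else 0)) e he
      (fun p _ => ?_) (fun p _ => ?_) (fun i _ => ?_) ?_ ?_ ?_
    · simp [hz, Fintype.sum_sum_type, add_comm]
    · simp [hcast, hwy, Fintype.sum_sum_type, add_comm]
    · calc _ ≤ ∑ p : Fin m, (1 : ℤ) := Finset.sum_le_sum fun p _ => by
            cases i with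
            | inl t => exact abs_effect_le t p
            | inr q => simp only [Sum.elim_inr]; split_ifs <;> simp
        _ = m := by simp
    · calc _ ≤ ∑ p : Fin m, (1 : ℤ) := Finset.sum_le_sum fun p _ => hb p
        _ = m := by simp
    · gcongr; omega
    · rw [mul_add, mul_one]
  · rw [Fintype.sum_sum_type] at hsum
    have h1 : ∑ j ∈ s, (w j).natAbs ≤ b := by
      refine le_trans (le_of_eq ?_) hb
      simp [hs, hw]
    have h2 : ∀ t, (w' (Sum.inl t)).natAbs = (w' (Sum.inl t)).toNat := fun t => by
      have := hnn t; omega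
    simp only [h2, hwy, Int.natAbs_natCast] at hsum
    exact hsum.trans ((growth_mono K).iterate n h1)

variable {β : Type*} {ρ : Fin n → β → β → Prop}

/-- A transition occurs at both levels. -/
def Step (N : PetriNet m n) (ρ : Fin n → β → β → Prop) (s s' : (Fin m → ℕ) × β) : Prop :=
  ∃ t, (N.vasTransition t).Holds s.1 s'.1 ∧ ρ t s.2 s'.2

/-- Among the transitions still to be fired, one has input places that none of them feeds. Such a
place only loses tokens during the rest of the block and ends nonnegative, so it holds a token now
and the transition is enabled. Induction on the number of remaining firings then orders the block.
-/
theorem Acyclic.fire (hN : N.Acyclic) {G : (Fin m → ℕ) × β → Prop} {X : β} {x' : Fin m → ℕ} {ℓ : ℕ}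
    (h : StepsTo (N.Step ρ) G ℓ (x', X)) (x : Fin m → ℕ) (c : Fin n → ℕ)
    (hc : ∀ t, c t ≠ 0 → ρ t X X) (hx : ∀ p, (x' p : ℤ) = x p + ∑ t, N.effect t p * c t) :
    StepsTo (N.Step ρ) G (∑ t, c t + ℓ) (x, X) := by
  induction hk : ∑ t, c t generalizing x c with
  | zero =>
    have h0 : ∀ t, c t = 0 := by simpa using hk
    have : x' = x := funext fun p => by
      have := hx p
      simp only [h0, Nat.cast_zero, mul_zero, Finset.sum_const_zero, add_zero] at this
      exact_mod_cast this
    rw [Nat.zero_add]; exact this ▸ h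
  | succ k ih =>
    obtain ⟨t, ht, hfirst⟩ := hN.exists_first {t | c t ≠ 0} (by
      by_contra hne
      have : ∀ t, c t = 0 := by simpa [Set.Nonempty] using hne
      simp [this] at hk)
    have hpre : ∀ p, N.placeToTrans p t = true → 1 ≤ x p := by
      intro p hp
      have hle : ∑ t', N.effect t' p * c t' ≤ N.effect t p * c t := by
        rw [← Finset.add_sum_erase _ _ (mem_univ t)]
        have : ∑ t' ∈ univ.erase t, N.effect t' p * c t' ≤ 0 :=
          Finset.sum_nonpos fun t' _ => by
            rcases eq_or_ne (c t') 0 with h0 | h0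
            · simp [h0]
            · have := hfirst t' h0 p hp
              refine mul_nonpos_of_nonpos_of_nonneg ?_ (by positivity)
              simp only [effect, this]
              split_ifs <;> simp_all
        linarith
      -- The transition `t` is itself among those that do not feed `p`, so `p` is not on a
      -- self-loop.
      have he : N.effect t p = -1 := by simp [effect, hfirst t ht p hp, hp]
      have := hx p
      have hct : 1 ≤ c t := Nat.one_le_iff_ne_zero.2 ht
      rw [he] at hle
      omega
    have hy : ∀ p, 0 ≤ (x p : ℤ) + N.effect t p := by
      intro p
      have := hpre p
      unfold effect
      split_ifs with h1 h2 h2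
      · omega
      · omega
      · have := this h2; omega
      · omega
    set c' : Fin n → ℕ := Function.update c t (c t - 1) with hc'
    have hct : c t = c' t + 1 := by
      have : c t ≠ 0 := ht
      simp [hc']; omega
    have hsum : ∀ {R : Type} [AddCommMonoid R] (f : Fin n → ℕ → R),
        ∑ t', f t' (c t') = f t (c t) + ∑ t' ∈ univ.erase t, f t' (c' t') := by
      intro R _ f
      rw [← Finset.add_sum_erase _ _ (mem_univ t)]
      congr 1
      exact Finset.sum_congr rfl fun t' h' => by
        rw [hc', Function.update_of_ne (Finset.ne_of_mem_erase h')]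
    have hsum' : ∀ {R : Type} [AddCommMonoid R] (f : Fin n → ℕ → R),
        ∑ t', f t' (c' t') = f t (c' t) + ∑ t' ∈ univ.erase t, f t' (c' t') := by
      intro R _ f
      rw [← Finset.add_sum_erase _ _ (mem_univ t)]
    have hstep : StepsTo (N.Step ρ) G (k + ℓ) (fun p => ((x p : ℤ) + N.effect t p).toNat, X) := by
      refine ih _ c' (fun t' h' => hc t' ?_) (fun p => ?_) ?_
      · rintro h0
        rcases eq_or_ne t' t with rfl | hne
        · exact ht h0
        · exact h' (by rw [hc', Function.update_of_ne hne, h0])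
      · rw [Int.toNat_of_nonneg (hy p), hx p, hsum fun t' k => N.effect t' p * (k : ℤ),
          hsum' fun t' k => N.effect t' p * (k : ℤ), hct]
        push_cast; ring
      · have h1 := hsum fun _ k => k
        have h2 := hsum' fun _ k => k
        omega
    rw [Nat.add_right_comm]
    exact ⟨_, ⟨t, (vasTransition_holds_iff t _ _).2
      ⟨hpre, fun p => Int.toNat_of_nonneg (hy p)⟩, hc t ht⟩, hstep⟩

/-! ### Bounded runs, by induction on the rank of the policy state -/

variable {rank : β → ℕ}

/-- A run starts with a block of transitions that do not change the policy level. -/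
theorem exists_first_block (hρ : ∀ t X X', ρ t X X' → X' = X ∨ rank X' < rank X)
    {G : (Fin m → ℕ) × β → Prop} {ℓ : ℕ} {x : Fin m → ℕ} {X : β}
    (h : StepsTo (N.Step ρ) G ℓ (x, X)) :
    ∃ (c : Fin n → ℕ) (x' : Fin m → ℕ), (∀ t, c t ≠ 0 → ρ t X X) ∧
      (∀ p, (x' p : ℤ) = x p + ∑ t, N.effect t p * c t) ∧
      (G (x', X) ∨ ∃ t x'' X' ℓ', (N.vasTransition t).Holds x' x'' ∧ ρ t X X' ∧
        rank X' < rank X ∧ StepsTo (N.Step ρ) G ℓ' (x'', X')) := by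
  induction ℓ generalizing x with
  | zero => exact ⟨0, x, by simp, by simp, .inl h⟩
  | succ ℓ ih =>
    obtain ⟨⟨x₁, X₁⟩, ⟨t, hv, hr⟩, h⟩ := h
    rcases hρ t _ _ hr with heq | hlt
    · dsimp only at heq hr
      subst heq
      obtain ⟨c, x', hc, hx', hd⟩ := ih h
      refine ⟨c + Pi.single t 1, x', fun t' h' => ?_, fun p => ?_, hd⟩
      · rcases eq_or_ne t' t with rfl | hne
        · exact hr
        · exact hc t' (by simpa [Pi.single_eq_of_ne hne] using h')
      · rw [hx' p, ((vasTransition_holds_iff t _ _).1 hv).2 p]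
        simp only [Pi.add_apply, Nat.cast_add, mul_add, Finset.sum_add_distrib]
        have : ∑ t', N.effect t' p * ((Pi.single t 1 : Fin n → ℕ) t' : ℤ) = N.effect t p := by
          rw [Finset.sum_eq_single t (fun t' _ hne => by simp [Pi.single_eq_of_ne hne])
            (by simp)]
          simp
        rw [this]; ring
    · exact ⟨0, x, by simp, by simp, .inr ⟨t, x₁, X₁, ℓ, hv, hr, hlt, h⟩⟩

/-- Runs to a goal of bounded precision can be transferred to equivalent markings, and the new
run is of bounded length. -/
theorem Acyclic.exists_bounded_run (hN : N.Acyclic)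
    (hρ : ∀ t X X', ρ t X X' → X' = X ∨ rank X' < rank X) {G : (Fin m → ℕ) × β → Prop} {L K : ℕ}
    (hL : 1 ≤ L) (hG : ∀ X (x y : Fin m → ℕ),
      FormEquiv L univ (fun p => (x p : ℤ)) (fun p => (y p : ℤ)) → G (x, X) → G (y, X))
    (d : ℕ) {X : β} {x y : Fin m → ℕ} {ℓ b : ℕ} (hX : rank X ≤ d)
    (hK : (blockLevel m n)^[d + 1] L ≤ K)
    (he : FormEquiv ((blockLevel m n)^[d + 1] L) univ (fun p => (x p : ℤ)) (fun p => (y p : ℤ)))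
    (h : StepsTo (N.Step ρ) G ℓ (x, X)) (hb : ∑ p, y p ≤ b) :
    ∃ ℓ', ℓ' + b ≤ (blockGrowth m n K)^[d + 1] b ∧ StepsTo (N.Step ρ) G ℓ' (y, X) := by
  induction d generalizing X x y ℓ b with
  | zero =>
    obtain ⟨c, x', hc, hx', hd⟩ := exists_first_block hρ h
    obtain ⟨c', hc', hblock, hsum⟩ := exists_block (N := N) (c := c) hL he hK hb
    have heq := hblock 0 (by simp)
    simp only [Pi.zero_apply, add_zero, ← hx'] at heq
    rcases hd with hd | ⟨t, x'', X', ℓ', hv, hr, hlt, -⟩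
    · have hnn : ∀ p, 0 ≤ (y p : ℤ) + ∑ t, N.effect t p * c' t := fun p =>
        (heq.le_iff (mem_univ p) hL (by simp)).1 (by simp)
      refine ⟨∑ t, c' t + 0, ?_, hN.fire (G := G)
        (x' := fun p => ((y p : ℤ) + ∑ t, N.effect t p * c' t).toNat) ?_ y c'
        (fun t ht => hc t fun h0 => ht (hc' t h0)) fun p => Int.toNat_of_nonneg (hnn p)⟩
      · have := add_le_blockGrowth m (a := ∑ t, c' t) (by omega) (K := K) (n := n) (b := b)
        simp only [zero_add, Function.iterate_one]
        omega
      · exact hG X x' _ (heq.congr (fun _ _ => rfl) fun p _ =>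
          (Int.toNat_of_nonneg (hnn p)).symm) hd
    -- At rank zero the policy state cannot change any more, so the whole run is one block.
    · omega
  | succ d ih =>
    rw [Function.iterate_succ_apply'] at he hK
    set M := (blockLevel m n)^[d + 1] L with hM
    have hLM : L ≤ M := le_blockLevel_iterate m n (d + 1) L
    have hM1 : 1 ≤ M := hL.trans hLM
    have hMK : M ≤ K := (le_blockLevel m n M).trans hK
    obtain ⟨c, x', hc, hx', hd⟩ := exists_first_block hρ h
    obtain ⟨c', hc', hblock, hsum⟩ := exists_block (N := N) (c := c) hM1 he hK hb
    have heq := hblock 0 (by simp)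
    simp only [Pi.zero_apply, add_zero, ← hx'] at heq
    have hnn : ∀ p, 0 ≤ (y p : ℤ) + ∑ t, N.effect t p * c' t := fun p =>
      (heq.le_iff (mem_univ p) hM1 (by simp)).1 (by simp)
    have hgrowth := add_le_blockGrowth m (a := ∑ t, c' t) (by omega) (K := K) (n := n) (b := b)
    have hgb : ∀ b, b ≤ blockGrowth m n K b := fun b => by
      have := add_le_blockGrowth m (Nat.zero_le ((growth K)^[n] b))
      omega
    set y' : Fin m → ℕ := fun p => ((y p : ℤ) + ∑ t, N.effect t p * c' t).toNat with hy'
    have hy'z : ∀ p, (y' p : ℤ) = (y p : ℤ) + ∑ t, N.effect t p * c' t := fun p =>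
      Int.toNat_of_nonneg (hnn p)
    have hfire : ∀ {ℓ}, StepsTo (N.Step ρ) G ℓ (y', X) →
        StepsTo (N.Step ρ) G (∑ t, c' t + ℓ) (y, X) := fun h =>
      hN.fire h y c' (fun t ht => hc t fun h0 => ht (hc' t h0)) hy'z
    simp only [← hy'z] at heq hblock
    rcases hd with hd | ⟨t, x'', X', ℓ', hv, hr, hlt, hrun⟩
    · refine ⟨_, ?_, hfire (ℓ := 0) (hG X x' _ (heq.mono hLM) hd)⟩
      rw [Function.iterate_succ_apply]
      refine le_trans ?_ (Function.id_le_iterate_of_id_le hgb (d + 1) (blockGrowth m n K b))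
      simp only [id]
      omega
    · rw [vasTransition_holds_iff] at hv
      -- The changing transition after the block is covered by the offset, so equivalence of
      -- precision `M` holds after it as well.
      have heq' := hblock (N.effect t) (abs_effect_le t)
      simp only [← hx', ← hv.2] at heq'
      have hnn' : ∀ p, 0 ≤ (y' p : ℤ) + N.effect t p := fun p =>
        (heq'.le_iff (mem_univ p) hM1 (by simp)).1 (by simp)
      set y'' : Fin m → ℕ := fun p => ((y' p : ℤ) + N.effect t p).toNat with hy''
      have hy''z : ∀ p, (y'' p : ℤ) = (y' p : ℤ) + N.effect t p := fun p =>
        Int.toNat_of_nonneg (hnn' p)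
      simp only [← hy''z] at heq'
      -- A firing adds at most one token to each place. This accounts for `m` of the factor `m + 2`
      -- in `blockGrowth`; the other two units pay for the old tokens and for the number of steps.
      have hy''b : ∑ p, y'' p ≤ blockGrowth m n K b := by
        have hp : ∀ p, (y'' p : ℤ) ≤ y p + (∑ t, c' t + 1 : ℕ) := by
          intro p
          rw [hy''z, hy'z]
          have h1 := (abs_le.1 (abs_effect_le (N := N) t p)).2
          have h2 : ∑ t, N.effect t p * c' t ≤ ∑ t, (c' t : ℤ) :=
            Finset.sum_le_sum fun t _ => by
              have := (abs_le.1 (abs_effect_le (N := N) t p)).2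
              nlinarith [Int.natCast_nonneg (c' t)]
          push_cast; linarith
        have : ∑ p, y'' p ≤ ∑ p, (y p + (∑ t, c' t + 1)) :=
          Finset.sum_le_sum fun p _ => by exact_mod_cast hp p
        rw [Finset.sum_add_distrib] at this
        simp only [Finset.sum_const, Finset.card_univ, Fintype.card_fin, smul_eq_mul] at this
        have h3 : m * (∑ t, c' t + 1) ≤ m * ((growth K)^[n] b + 1) := by gcongr; omega
        rw [blockGrowth, add_mul]
        omega
      obtain ⟨ℓ₂, hℓ₂, hrun'⟩ := ih (by omega) hMK heq' hrun hy''b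
      refine ⟨∑ t, c' t + (ℓ₂ + 1), ?_, hfire ⟨(y'', X'), ⟨t, ?_, hr⟩, hrun'⟩⟩
      · rw [Function.iterate_succ_apply]
        -- The induction hypothesis has `blockGrowth m n K b` added to `ℓ₂`, which absorbs the
        -- firings of the block, the changing transition and `b`.
        refine le_trans ?_ hℓ₂
        omega
      · rw [vasTransition_holds_iff]
        refine ⟨fun p hp => ?_, hy''z⟩
        have := (heq.le_iff (mem_univ p) hM1 (k := 1) (by simpa using hM1)).1
          (by exact_mod_cast hv.1 p hp)
        exact_mod_cast this

/-- A goal reachable from some initial marking is reachable by a bounded run from a bounded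
initial marking. -/
theorem Acyclic.exists_bounded_run_of_init (hN : N.Acyclic)
    (hρ : ∀ t X X', ρ t X X' → X' = X ∨ rank X' < rank X) {G : (Fin m → ℕ) × β → Prop}
    {I : (Fin m → ℕ) → Prop} {L K d : ℕ}
    (hL : 1 ≤ L) (hG : ∀ X (x y : Fin m → ℕ),
      FormEquiv L univ (fun p => (x p : ℤ)) (fun p => (y p : ℤ)) → G (x, X) → G (y, X))
    (hI : ∀ x y : Fin m → ℕ,
      FormEquiv L univ (fun p => (x p : ℤ)) (fun p => (y p : ℤ)) → I x → I y)
    {X : β} {x : Fin m → ℕ} {ℓ : ℕ} (hX : rank X ≤ d)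
    (hK : gap^[m] ((blockLevel m n)^[d + 1] L) ≤ K) (hIx : I x)
    (h : StepsTo (N.Step ρ) G ℓ (x, X)) :
    ∃ ℓ' y, ℓ' + ∑ p, y p ≤ (blockGrowth m n K)^[d + 1] ((growth K)^[m] 0) ∧ I y ∧
      StepsTo (N.Step ρ) G ℓ' (y, X) := by
  -- Empty tuples are equivalent to every precision, so a bounded marking equivalent to `x` is built
  -- from nothing by adding all `m` entries.
  obtain ⟨y', -, he, hsum⟩ := FormEquiv.extend_finset (N := (blockLevel m n)^[d + 1] L) (K := K)
    (s := ∅) (t := univ) (x := fun p => (x p : ℤ)) (y := 0) (by simp) (FormEquiv.empty _ _ _)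
    (by simpa using hK)
  simp only [Finset.union_empty, Finset.card_univ, Fintype.card_fin, Finset.sum_empty] at he hsum
  have hLM := le_blockLevel_iterate m n (d + 1) L
  have hnn : ∀ p, 0 ≤ y' p := fun p =>
    (he.le_iff (mem_univ p) (hL.trans hLM) (by simp)).1 (by simp)
  have hy' : ∀ p, ((y' p).toNat : ℤ) = y' p := fun p => Int.toNat_of_nonneg (hnn p)
  have he' := he.congr (y' := fun p => ((y' p).toNat : ℤ)) (fun _ _ => rfl) fun p _ => (hy' p).symm
  obtain ⟨ℓ', hℓ', hrun⟩ := hN.exists_bounded_run hρ hL hG d hX ((le_gap_iterate _ _).trans hK) he'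
    h (b := (growth K)^[m] 0) (le_trans (Finset.sum_le_sum fun p _ => by omega) hsum)
  refine ⟨ℓ', fun p => (y' p).toNat, ?_, hI _ _ (he'.mono hLM) hIx, hrun⟩
  refine le_trans (Nat.add_le_add_left ?_ _) hℓ'
  exact le_trans (Finset.sum_le_sum fun p _ => by omega) hsum

end PetriNet

/-! ### Closure properties of primitive recursive functions -/

-- Once the two predicates are registered, `fun_prop` follows the syntax of a definition; the
-- closure properties are stated for compositions for this purpose.
attribute [fun_prop] Primrec
attribute [fun_prop] PrimrecPred

namespace PR

variable {α β γ σ : Type*} [Primcodable α] [Primcodable β] [Primcodable γ] [Primcodable σ]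

@[fun_prop] theorem id : Primrec (fun a : α => a) := Primrec.id

@[fun_prop] theorem const (b : β) : Primrec (fun _ : α => b) := Primrec.const b

@[fun_prop] theorem comp {f : β → γ} {g : α → β} (hf : Primrec f) (hg : Primrec g) :
    Primrec (fun a => f (g a)) := hf.comp hg

@[fun_prop] theorem fst {f : α → β × γ} (hf : Primrec f) : Primrec (fun a => (f a).1) :=
  Primrec.fst.comp hf

@[fun_prop] theorem snd {f : α → β × γ} (hf : Primrec f) : Primrec (fun a => (f a).2) :=
  Primrec.snd.comp hf

@[fun_prop] theorem prodMk {f : α → β} {g : α → γ} (hf : Primrec f) (hg : Primrec g) :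
    Primrec (fun a => (f a, g a)) := hf.pair hg

section Nat

variable {f g h : α → ℕ} (hf : Primrec f) (hg : Primrec g) (hh : Primrec h)
include hf

@[fun_prop] theorem unpair : Primrec (fun a => (f a).unpair) := Primrec.unpair.comp hf

include hg

@[fun_prop] theorem pair : Primrec (fun a => Nat.pair (f a) (g a)) :=
  Primrec₂.natPair.comp hf hg

@[fun_prop] theorem add : Primrec (fun a => f a + g a) := Primrec.nat_add.comp hf hg

@[fun_prop] theorem sub : Primrec (fun a => f a - g a) := Primrec.nat_sub.comp hf hg

@[fun_prop] theorem mul : Primrec (fun a => f a * g a) := Primrec.nat_mul.comp hf hg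

@[fun_prop] theorem div : Primrec (fun a => f a / g a) := Primrec.nat_div.comp hf hg

@[fun_prop] theorem mod : Primrec (fun a => f a % g a) := Primrec.nat_mod.comp hf hg

@[fun_prop] theorem pow : Primrec (fun a => f a ^ g a) :=
  (Primrec₂.unpaired'.1 Nat.Primrec.pow).comp hf hg

@[fun_prop] theorem lt : PrimrecPred (fun a => f a < g a) := Primrec.nat_lt.comp hf hg

@[fun_prop] theorem le : PrimrecPred (fun a => f a ≤ g a) := Primrec.nat_le.comp hf hg

end Nat

@[fun_prop] theorem eq [DecidableEq β] {f g : α → β} (hf : Primrec f) (hg : Primrec g) :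
    PrimrecPred (fun a => f a = g a) := PrimrecRel.comp Primrec.eq hf hg

@[fun_prop] theorem not {p : α → Prop} (hp : PrimrecPred p) : PrimrecPred (fun a => ¬ p a) :=
  hp.not

@[fun_prop] theorem and {p q : α → Prop} (hp : PrimrecPred p) (hq : PrimrecPred q) :
    PrimrecPred (fun a => p a ∧ q a) := hp.and hq

@[fun_prop] theorem or {p q : α → Prop} (hp : PrimrecPred p) (hq : PrimrecPred q) :
    PrimrecPred (fun a => p a ∨ q a) := hp.or hq

@[fun_prop] theorem ne [DecidableEq β] {f g : α → β} (hf : Primrec f) (hg : Primrec g) :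
    PrimrecPred (fun a => f a ≠ g a) := (eq hf hg).not

theorem imp {p q : α → Prop} (hp : PrimrecPred p) (hq : PrimrecPred q) :
    PrimrecPred (fun a => p a → q a) :=
  (hp.not.or hq).of_eq fun a => by tauto

@[fun_prop] theorem iff {p q : α → Prop} (hp : PrimrecPred p) (hq : PrimrecPred q) :
    PrimrecPred (fun a => p a ↔ q a) :=
  ((imp hp hq).and (imp hq hp)).of_eq fun a => by tauto

@[fun_prop] theorem exists_lt {f : α → ℕ} {P : α → ℕ → Prop} (hf : Primrec f)
    (hP : PrimrecPred fun q : α × ℕ => P q.1 q.2) : PrimrecPred (fun a => ∃ x < f a, P a x) :=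
  ((PrimrecRel.exists_mem_list (R := fun x a => P a x)
    (hP.comp (Primrec.snd.pair Primrec.fst))).comp (Primrec.list_range.comp hf) Primrec.id).of_eq
      fun a => by simp

theorem forall_lt {f : α → ℕ} {P : α → ℕ → Prop} (hf : Primrec f)
    (hP : PrimrecPred fun q : α × ℕ => P q.1 q.2) : PrimrecPred (fun a => ∀ x < f a, P a x) :=
  ((PrimrecRel.forall_mem_list (R := fun x a => P a x)
    (hP.comp (Primrec.snd.pair Primrec.fst))).comp (Primrec.list_range.comp hf) Primrec.id).of_eq
      fun a => by simp

@[fun_prop] theorem decide {p : α → Prop} [DecidablePred p] (hp : PrimrecPred p) :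
    Primrec (fun a => decide (p a)) := hp.decide

@[fun_prop] theorem ite {p : α → Prop} [DecidablePred p] (hp : PrimrecPred p) {f g : α → σ}
    (hf : Primrec f) (hg : Primrec g) : Primrec (fun a => if p a then f a else g a) :=
  Primrec.ite hp hf hg

theorem iterate {F : α → β → β} {f : α → ℕ} {g : α → β}
    (hF : Primrec fun q : α × β => F q.1 q.2) (hf : Primrec f) (hg : Primrec g) :
    Primrec (fun a => (F a)^[f a] (g a)) :=
  Primrec.nat_iterate hf hg hF

@[fun_prop] theorem getD {f : α → List β} {g : α → ℕ} (hf : Primrec f) (hg : Primrec g) (d : β) :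
    Primrec (fun a => (f a).getD (g a) d) := (Primrec.list_getD d).comp hf hg

@[fun_prop] theorem length {f : α → List β} (hf : Primrec f) :
    Primrec (fun a => (f a).length) := Primrec.list_length.comp hf

theorem map_range {f : α → ℕ} {F : α → ℕ → β} (hf : Primrec f)
    (hF : Primrec fun q : α × ℕ => F q.1 q.2) :
    Primrec (fun a => (List.range (f a)).map (F a)) :=
  Primrec.list_map (Primrec.list_range.comp hf) hF

@[fun_prop] theorem factorial {f : α → ℕ} (hf : Primrec f) :
    Primrec (fun a => (f a).factorial) := by
  have h : Primrec Nat.factorial := by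
    refine (Primrec.nat_rec₁ (f := fun k v => (k + 1) * v) 1 ?_).of_eq fun k => ?_
    · show Primrec fun q : ℕ × ℕ => (q.1 + 1) * q.2
      fun_prop
    · induction k with
      | zero => rfl
      | succ k ih => rw [Nat.factorial_succ, ← ih]
  exact h.comp hf

end PR

/-! ### Recursion over codes of trees -/

section Tree

variable {α σ : Type*}

/-- The list of the values at `0, …, c - 1` of the function defined by course-of-values
recursion. -/
def treeTable (step : α → List σ → σ) (a : α) : ℕ → List σ
  | 0 => []
  | c + 1 => treeTable step a c ++ [step a (treeTable step a c)]

/-- The function defined by course-of-values recursion. -/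
def treeRec (step : α → List σ → σ) (a : α) (c : ℕ) : σ := step a (treeTable step a c)

@[simp] theorem treeTable_length (step : α → List σ → σ) (a : α) (c : ℕ) :
    (treeTable step a c).length = c := by
  induction c with
  | zero => rfl
  | succ c ih => simp [treeTable, ih]

/-- This is how a clause calls itself on the children of a node, whose codes are smaller; the
default value is never reached. -/
theorem treeTable_getD (step : α → List σ → σ) (a : α) {i c : ℕ} (h : i < c) (d : σ) :
    (treeTable step a c).getD i d = treeRec step a i := by
  induction c with
  | zero => omega
  | succ c ih =>
    rw [treeTable]
    rcases Nat.lt_succ_iff_lt_or_eq.1 h with h | rfl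
    · rw [List.getD_append _ _ _ _ (by simpa using h), ih h]
    · rw [List.getD_append_right _ _ _ _ (by simp)]
      simp [treeRec]

theorem PR.treeRec {β : Type*} [Primcodable α] [Primcodable β] [Primcodable σ]
    {step : α → List σ → σ} (hs : Primrec fun q : α × List σ => step q.1 q.2) {f : β → α}
    {g : β → ℕ} (hf : Primrec f) (hg : Primrec g) :
    Primrec fun b => treeRec step (f b) (g b) := by
  have h : Primrec fun b => treeTable step (f b) (g b) := by
    refine (Primrec.nat_rec' (f := g) (g := fun _ => ([] : List σ))
      (h := fun b q => q.2 ++ [step (f b) q.2]) hg (Primrec.const _) ?_).of_eq fun b => ?_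
    · show Primrec fun q : β × ℕ × List σ => q.2.2 ++ [step (f q.1) q.2.2]
      refine Primrec.list_concat.comp (by fun_prop) ?_
      exact hs.comp (Primrec.pair (by fun_prop) (by fun_prop))
    · induction g b with
      | zero => rfl
      | succ c ih => rw [treeTable, ← ih]
  exact hs.comp (hf.pair h)

end Tree

/-! ### Codes of sequences -/

/-- The entries of a sequence, from its code. -/
def entry (c i : ℕ) : ℕ := (Denumerable.ofNat (List ℕ) c).getD i 0

@[simp] theorem entry_seqCode {n : ℕ} (f : Fin n → ℕ) (i : Fin n) : entry (seqCode f) i = f i := by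
  simp [entry, seqCode]

@[fun_prop] theorem PR.entry {α : Type*} [Primcodable α] {f g : α → ℕ} (hf : Primrec f)
    (hg : Primrec g) : Primrec fun a => entry (f a) (g a) :=
  (Primrec.list_getD 0).comp ((Primrec.ofNat (List ℕ)).comp hf) hg

theorem le_encode_list (l : List ℕ) (x : ℕ) (h : x ∈ l) : x ≤ Encodable.encode l := by
  induction l with
  | nil => simp at h
  | cons y l ih =>
    rw [Encodable.encode_list_cons]
    have := Nat.add_le_pair (Encodable.encode y) (Encodable.encode l)
    rcases List.mem_cons.1 h with rfl | h
    · simp only [Encodable.encode_nat] at this ⊢; omega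
    · have := ih h; omega

theorem le_seqCode {n : ℕ} (f : Fin n → ℕ) (i : Fin n) : f i ≤ seqCode f :=
  le_encode_list _ _ (List.mem_ofFn.2 ⟨i, rfl⟩)

/-- The digit of `x` at position `i` in base `b`. -/
def digit (b x i : ℕ) : ℕ := x / b ^ i % b

@[fun_prop] theorem PR.digit {α : Type*} [Primcodable α] {f g h : α → ℕ} (hf : Primrec f)
    (hg : Primrec g) (hh : Primrec h) : Primrec fun a => digit (f a) (g a) (h a) := by
  unfold WebService.digit; fun_prop

/-- Quantifiers over finite functions (interpretations of `xcd`, assignments, markings, runs)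
thereby become bounded quantifiers over numbers. -/
theorem exists_digits {b : ℕ} (k : ℕ) (f : ℕ → ℕ) (hf : ∀ i < k, f i < b) :
    ∃ x < b ^ k, ∀ i < k, digit b x i = f i := by
  induction k generalizing f with
  | zero => exact ⟨0, by simp, by simp⟩
  | succ k ih =>
    obtain ⟨x, hx, h⟩ := ih (fun i => f (i + 1)) fun i hi => hf (i + 1) (by omega)
    have h0 := hf 0 (by omega)
    refine ⟨f 0 + b * x, ?_, fun i hi => ?_⟩
    · rw [pow_succ']; nlinarith
    · cases i with
      | zero => simp [digit, Nat.mod_eq_of_lt h0]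
      | succ i =>
        rw [← h i (by omega), digit, digit, pow_succ', ← Nat.div_div_eq_div_mul,
          Nat.add_mul_div_left _ _ (by omega), Nat.div_eq_of_lt h0, zero_add]

@[simp] theorem nodeCode_fst (tag x y : ℕ) : (nodeCode tag x y).unpair.1 = tag := by
  simp [nodeCode]

@[simp] theorem nodeCode_snd_fst (tag x y : ℕ) : (nodeCode tag x y).unpair.2.unpair.1 = x := by
  simp [nodeCode]

@[simp] theorem nodeCode_snd_snd (tag x y : ℕ) : (nodeCode tag x y).unpair.2.unpair.2 = y := by
  simp [nodeCode]

/-! ### Evaluation of coded quantifier-free formulas -/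

/-- The entry for the sort with code `s` of a coded family indexed by the sorts. -/
def sortEntry (Γ s : ℕ) : ℕ :=
  if s = 0 then Γ.unpair.1.unpair.1 else if s = 1 then Γ.unpair.1.unpair.2
  else if s = 2 then Γ.unpair.2.unpair.1 else Γ.unpair.2.unpair.2

@[simp] theorem sortEntry_sortCode (Γ : Srt → ℕ) (s : Srt) :
    sortEntry (sortCode Γ) s.code = Γ s := by
  cases s <;> simp [sortEntry, sortCode, Srt.code]

theorem sortEntry_le (Γ s : ℕ) : sortEntry Γ s ≤ Γ := by
  have h1 := Nat.unpair_left_le Γ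
  have h2 := Nat.unpair_right_le Γ
  have h3 := Nat.unpair_left_le Γ.unpair.1
  have h4 := Nat.unpair_right_le Γ.unpair.1
  have h5 := Nat.unpair_left_le Γ.unpair.2
  have h6 := Nat.unpair_right_le Γ.unpair.2
  unfold sortEntry; split_ifs <;> omega

/-- The data needed to evaluate a formula: the code of the structure, the digits of `xcd`, the
code of the numbers of variables in the first group, the digits of the values of the first and of
the second group of variables. -/
abbrev EvalContext : Type := ℕ × ℕ × ℕ × ℕ × ℕ

/-- The value of the variable `i` of sort `s`. -/
def varVal (C : EvalContext) (s i : ℕ) : ℕ :=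
  (if i < sortEntry C.2.2.1 s then digit (C.1 + 1) C.2.2.2.1 (4 * i + s)
    else digit (C.1 + 1) C.2.2.2.2 (4 * (i - sortEntry C.2.2.1 s) + s)) % sortEntry C.1.unpair.1 s

/-- The value of a coded term of sort `s`. -/
def termVal (C : EvalContext) (s t : ℕ) : ℕ :=
  if t.unpair.1 = 0 then varVal C s t.unpair.2 else t.unpair.2

/-- The truth value of `xcd`. -/
def XcdBit (A X u a : ℕ) : Prop := digit 2 X (u * sortEntry A.unpair.1 3 + a) = 1

/-- The clauses of the definition of satisfaction; `l` lists the truth values of the formulas with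
smaller codes. -/
def QFClause (C : EvalContext) (l : List Bool) (tag x y : ℕ) : Prop :=
  (tag = 0 ∧ termVal C x y.unpair.1 = termVal C x y.unpair.2) ∨
  (tag = 1 ∧ entry (entry C.1.unpair.2.unpair.1 (termVal C 0 x)) (termVal C 1 y) = 1) ∨
  (tag = 2 ∧ entry (entry C.1.unpair.2.unpair.2.unpair.1 (termVal C 1 x)) (termVal C 2 y) = 1) ∨
  (tag = 3 ∧ entry (entry C.1.unpair.2.unpair.2.unpair.2 (termVal C 1 x)) (termVal C 1 y) = 1) ∨
  (tag = 4 ∧ XcdBit C.1 C.2.1 (termVal C 0 x) (termVal C 3 y)) ∨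
  (tag = 5 ∧ ¬ l.getD x false = true) ∨
  (tag = 6 ∧ l.getD x false = true ∧ l.getD y false = true) ∨
  (tag = 7 ∧ (l.getD x false = true ∨ l.getD y false = true))

open Classical in
/-- The truth value of the formula whose code is the length of `l`. -/
noncomputable def qfStep (C : EvalContext) (l : List Bool) : Bool :=
  decide (QFClause C l l.length.unpair.1 l.length.unpair.2.unpair.1 l.length.unpair.2.unpair.2)

/-- Satisfaction of a coded quantifier-free formula. -/
def QFHolds (C : EvalContext) (c : ℕ) : Prop := treeRec qfStep C c = true

namespace PR

variable {α : Type*} [Primcodable α] {f g h k : α → ℕ} {C : α → EvalContext}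

@[fun_prop] theorem sortEntry (hf : Primrec f) (hg : Primrec g) :
    Primrec fun a => sortEntry (f a) (g a) := by
  unfold WebService.sortEntry; fun_prop

@[fun_prop] theorem termVal (hC : Primrec C) (hf : Primrec f) (hg : Primrec g) :
    Primrec fun a => termVal (C a) (f a) (g a) := by
  unfold WebService.termVal WebService.varVal; fun_prop

@[fun_prop] theorem varVal (hC : Primrec C) (hf : Primrec f) (hg : Primrec g) :
    Primrec fun a => varVal (C a) (f a) (g a) := by
  unfold WebService.varVal; fun_prop

@[fun_prop] theorem xcdBit (hf : Primrec f) (hg : Primrec g) (hh : Primrec h) (hk : Primrec k) :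
    PrimrecPred fun a => XcdBit (f a) (g a) (h a) (k a) := by
  unfold XcdBit; fun_prop

@[fun_prop] theorem qfHolds (hC : Primrec C) (hf : Primrec f) :
    PrimrecPred fun a => QFHolds (C a) (f a) := by
  have : Primrec fun q : EvalContext × List Bool => qfStep q.1 q.2 := by
    unfold qfStep QFClause; fun_prop
  exact eq (treeRec this hC hf) (const true)

end PR

theorem qfHolds_nodeCode (C : EvalContext) (tag x y : ℕ) :
    QFHolds C (nodeCode tag x y) ↔ QFClause C (treeTable qfStep C (nodeCode tag x y)) tag x y := by
  rw [QFHolds, treeRec, qfStep, treeTable_length, nodeCode_fst, nodeCode_snd_fst,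
    nodeCode_snd_snd]
  exact @decide_eq_true_iff _ (Classical.propDecidable _)

/-- The interpretation of `xcd` given by a number. -/
def RBACStructure.toXcd (A : RBACStructure) (X : ℕ) : A.Xcd :=
  fun u a => XcdBit A.code X u a

theorem RBACStructure.sortEntry_code (A : RBACStructure) (s : Srt) :
    sortEntry A.code.unpair.1 s.code = A.size s := by
  simp [RBACStructure.code]

theorem RBACStructure.exists_toXcd (A : RBACStructure) (X : A.Xcd) :
    ∃ c < 2 ^ (A.size .user * A.size .action), A.toXcd c = X := by
  classical
  set p := A.size .action with hp
  have hp0 : 0 < p := A.size_pos .action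
  obtain ⟨c, hc, h⟩ := exists_digits (b := 2) (A.size .user * p)
    (fun i => if h : i / p < A.size .user then
      (if X ⟨i / p, h⟩ ⟨i % p, Nat.mod_lt _ hp0⟩ then 1 else 0) else 0)
    (fun i _ => by split_ifs <;> omega)
  refine ⟨c, hc, funext fun u => funext fun a => ?_⟩
  have h1 : (u * p + a : ℕ) / p = u := by
    rw [mul_comm, Nat.mul_add_div hp0, Nat.div_eq_of_lt a.2, add_zero]
  have h2 : (u * p + a : ℕ) % p = a := by
    rw [mul_comm, Nat.mul_add_mod, Nat.mod_eq_of_lt a.2]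
  have h3 : sortEntry A.code.unpair.1 3 = p := A.sortEntry_code .action
  have h4 : (u * p + a : ℕ) < A.size .user * p := by
    have := u.2; have := a.2
    calc (u * p + a : ℕ) < u * p + p := by omega
      _ = (u + 1) * p := by ring
      _ ≤ _ := Nat.mul_le_mul_right _ (by omega)
  rw [toXcd, XcdBit, h3, h _ h4]
  simp [h1, h2]

theorem RBACStructure.size_le_code (A : RBACStructure) (s : Srt) : A.size s ≤ A.code := by
  rw [← A.sortEntry_code s]
  exact (sortEntry_le _ _).trans (Nat.unpair_left_le _)

/-- The assignment given by a number. -/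
def RBACStructure.toAssignment (A : RBACStructure) (Γ : Srt → ℕ) (w : ℕ) :
    Assignment A.size Γ :=
  fun s i => ⟨digit (A.code + 1) w (4 * i + s.code) % A.size s, Nat.mod_lt _ (A.size_pos s)⟩

/-- A bound for the numbers representing assignments. -/
def assignmentBound (A Γ : ℕ) : ℕ := (A + 1) ^ (4 * Γ)

theorem Srt.code_lt (s : Srt) : s.code < 4 := by cases s <;> simp [Srt.code]

/-- The positions `4 * i + s.code` interleave the four sorts, and the base exceeds every sort size
because sizes are bounded by the code. Since digits are reduced modulo the size, every number
represents some assignment, so numerical quantifiers need no side condition. -/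
theorem RBACStructure.exists_toAssignment (A : RBACStructure) (Γ : Srt → ℕ)
    (ρ : Assignment A.size Γ) :
    ∃ w < assignmentBound A.code (sortCode Γ), A.toAssignment Γ w = ρ := by
  obtain ⟨w, hw, h⟩ := exists_digits (b := A.code + 1) (4 * sortCode Γ)
    (fun j => match j % 4 with
      | 0 => if h : j / 4 < Γ .user then ρ .user ⟨j / 4, h⟩ else 0
      | 1 => if h : j / 4 < Γ .role then ρ .role ⟨j / 4, h⟩ else 0
      | 2 => if h : j / 4 < Γ .permission then ρ .permission ⟨j / 4, h⟩ else 0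
      | _ => if h : j / 4 < Γ .action then ρ .action ⟨j / 4, h⟩ else 0)
    (fun j _ => by
      have key : ∀ s, (if h : j / 4 < Γ s then (ρ s ⟨j / 4, h⟩ : ℕ) else 0) < A.code + 1 := by
        intro s
        have := A.size_le_code s
        split_ifs with h
        · have := (ρ s ⟨j / 4, h⟩).2; omega
        · omega
      split
      exacts [key .user, key .role, key .permission, key .action])
  refine ⟨w, hw, funext fun s => funext fun i => Fin.ext ?_⟩
  have h1 : Γ s ≤ sortCode Γ := by
    rw [← sortEntry_sortCode Γ s]; exact sortEntry_le _ _
  have h2 := i.2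
  have h3 := s.code_lt
  have h4 := (ρ s i).2
  have h5 : (4 * (i : ℕ) + s.code) / 4 = i := by omega
  have h6 : (4 * (i : ℕ) + s.code) % 4 = s.code := by omega
  simp only [toAssignment]
  rw [h _ (by omega)]
  simp only [h5, h6]
  cases s <;> simp [Srt.code, Nat.mod_eq_of_lt h4]

/-- The assignment enters only through `hρ`, which covers both a single group of variables and the
two groups of a BSR formula. -/
theorem qfHolds_code (A : RBACStructure) {Γ : Srt → ℕ} (X ex z w : ℕ) (ρ : Assignment A.size Γ)
    (hρ : ∀ s (i : Fin (Γ s)), varVal (A.code, X, ex, z, w) s.code i = ρ s i)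
    (φ : QFFormula A.size Γ) :
    QFHolds (A.code, X, ex, z, w) φ.code ↔ φ.Holds A (A.toXcd X) ρ := by
  have hterm : ∀ s (t : PTerm A.size Γ s),
      termVal (A.code, X, ex, z, w) s.code t.code = t.eval ρ := by
    intro s t
    cases t with
    | var i => simp [termVal, PTerm.code, PTerm.eval, hρ]
    | const c => simp [termVal, PTerm.code, PTerm.eval]
  have hu := hterm .user
  have hr := hterm .role
  have hp := hterm .permission
  have ha := hterm .action
  simp only [Srt.code] at hu hr hp ha
  have hua : A.code.unpair.2.unpair.1 = tableCode A.ua := by simp [RBACStructure.code]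
  have hpa : A.code.unpair.2.unpair.2.unpair.1 = tableCode A.pa := by simp [RBACStructure.code]
  have hhier : A.code.unpair.2.unpair.2.unpair.2 = tableCode A.hier := by
    simp [RBACStructure.code]
  have htab : ∀ {c i : ℕ}, i < c →
      ((treeTable qfStep (A.code, X, ex, z, w) c).getD i false = true ↔
        QFHolds (A.code, X, ex, z, w) i) := by
    intro c i h
    rw [treeTable_getD _ _ h]; rfl
  induction φ with
  | eq s a b =>
    rw [QFFormula.code, qfHolds_nodeCode]
    simp [QFClause, QFFormula.Holds, hterm, Fin.val_inj]
  | ua u r =>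
    rw [QFFormula.code, qfHolds_nodeCode]
    simp [QFClause, QFFormula.Holds, hu, hr, hua, tableCode]
  | pa r p =>
    rw [QFFormula.code, qfHolds_nodeCode]
    simp [QFClause, QFFormula.Holds, hp, hr, hpa, tableCode]
  | hier r r' =>
    rw [QFFormula.code, qfHolds_nodeCode]
    simp [QFClause, QFFormula.Holds, hr, hhier, tableCode]
  | xcd u a =>
    rw [QFFormula.code, qfHolds_nodeCode]
    simp [QFClause, QFFormula.Holds, hu, ha, RBACStructure.toXcd]
  | not φ ih =>
    have := add_le_nodeCode 5 φ.code 0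
    rw [QFFormula.code, qfHolds_nodeCode, QFClause, htab (by omega)]
    simp [QFFormula.Holds, ih]
  | and φ ψ ih ih' =>
    have := add_le_nodeCode 6 φ.code ψ.code
    rw [QFFormula.code, qfHolds_nodeCode, QFClause, htab (by omega), htab (by omega)]
    simp [QFFormula.Holds, ih, ih']
  | or φ ψ ih ih' =>
    have := add_le_nodeCode 7 φ.code ψ.code
    rw [QFFormula.code, qfHolds_nodeCode, QFClause, htab (by omega), htab (by omega)]
    simp [QFFormula.Holds, ih, ih']

/-- Satisfaction of a formula with one group of variables. -/
theorem qfHolds_toAssignment (A : RBACStructure) {Γ : Srt → ℕ} (X w : ℕ)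
    (φ : QFFormula A.size Γ) :
    QFHolds (A.code, X, 0, 0, w) φ.code ↔ φ.Holds A (A.toXcd X) (A.toAssignment Γ w) := by
  refine qfHolds_code A X 0 0 w _ (fun s i => ?_) φ
  have : sortEntry 0 s.code = 0 := Nat.le_zero.1 (sortEntry_le 0 _)
  simp [varVal, this, A.sortEntry_code, RBACStructure.toAssignment]

theorem qfHolds_append (A : RBACStructure) {Γ Δ : Srt → ℕ} (X z w : ℕ)
    (φ : QFFormula A.size (fun s => Γ s + Δ s)) :
    QFHolds (A.code, X, sortCode Γ, z, w) φ.code ↔ φ.Holds A (A.toXcd X)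
      (fun s => Fin.append (A.toAssignment Γ z s) (A.toAssignment Δ w s)) := by
  refine qfHolds_code A X (sortCode Γ) z w _ (fun s i => ?_) φ
  induction i using Fin.addCases with
  | left i => simp [varVal, A.sortEntry_code, RBACStructure.toAssignment]
  | right i => simp [varVal, A.sortEntry_code, RBACStructure.toAssignment]

/-! ### Evaluation of coded formulas of linear arithmetic -/

/-- The integer given by a code. -/
def intVal (v : ℕ) : ℤ := (v.unpair.1 : ℤ) - v.unpair.2

theorem intVal_intCode (c : ℤ) : intVal (intCode c) = c := by
  simp [intVal, intCode]

/-- The code of the value of the variable `i`; an environment is a coded list. -/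
def envGet (e i : ℕ) : ℕ := ((fun e => e.unpair.2)^[i] e).unpair.1

@[simp] theorem envGet_pair_zero (v e : ℕ) : envGet (Nat.pair v e) 0 = v := by simp [envGet]

@[simp] theorem envGet_pair_succ (v e i : ℕ) : envGet (Nat.pair v e) (i + 1) = envGet e i := by
  simp [envGet]

/-- Pairing dominates addition, so the bound for a quantified value can be computed from the
environment's code alone. -/
theorem sum_envGet_le (k e : ℕ) : ∑ i : Fin k, (intVal (envGet e i)).natAbs ≤ e := by
  induction k generalizing e with
  | zero => simp
  | succ k ih =>
    rw [Fin.sum_univ_succ, ← Nat.pair_unpair e]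
    have h1 := ih e.unpair.2
    have h2 := Nat.add_le_pair e.unpair.1 e.unpair.2
    have h3 := Nat.unpair_add_le e.unpair.1
    have h4 : (intVal e.unpair.1).natAbs ≤ e.unpair.1 := by unfold intVal; omega
    simp only [Fin.val_zero, envGet_pair_zero, Fin.val_succ, envGet_pair_succ]
    omega

/-- The clauses of the definition of the value of a term; `l` lists the values of the terms with
smaller codes. -/
def laTermClause (e : ℕ) (l : List ℕ) (tag x y : ℕ) : ℕ :=
  if tag = 0 then envGet e x
  else if tag = 1 then x
  else if tag = 2 then
    Nat.pair ((l.getD x 0).unpair.1 + (l.getD y 0).unpair.1)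
      ((l.getD x 0).unpair.2 + (l.getD y 0).unpair.2)
  else
    Nat.pair (x.unpair.1 * (l.getD y 0).unpair.1 + x.unpair.2 * (l.getD y 0).unpair.2)
      (x.unpair.1 * (l.getD y 0).unpair.2 + x.unpair.2 * (l.getD y 0).unpair.1)

/-- The code of the value of the term whose code is the length of `l`. -/
def laTermStep (e : ℕ) (l : List ℕ) : ℕ :=
  laTermClause e l l.length.unpair.1 l.length.unpair.2.unpair.1 l.length.unpair.2.unpair.2

/-- The code of the value of a coded term. -/
def laTermVal (e t : ℕ) : ℕ := treeRec laTermStep e t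

/-- Values are unnormalised differences of two naturals, which keeps the arithmetic within ℕ; only
their `intVal` is meaningful. -/
theorem laTermVal_code {k : ℕ} (e : ℕ) (x : Fin k → ℤ) (hx : ∀ i : Fin k, intVal (envGet e i) = x i)
    (t : LATerm k) : intVal (laTermVal e t.code) = t.eval x := by
  induction t with
  | var i => simp [laTermVal, treeRec, laTermStep, laTermClause, LATerm.code, LATerm.eval, hx]
  | const c =>
    simp [laTermVal, treeRec, laTermStep, laTermClause, LATerm.code, LATerm.eval, intVal_intCode]
  | add s t hs ht =>
    have := add_le_nodeCode 2 s.code t.code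
    rw [laTermVal, LATerm.code, treeRec, laTermStep, treeTable_length, nodeCode_fst,
      nodeCode_snd_fst, nodeCode_snd_snd, laTermClause, treeTable_getD (i := s.code) _ _ (by omega),
      treeTable_getD (i := t.code) _ _ (by omega), LATerm.eval, ← hs, ← ht]
    simp [intVal, laTermVal]
    ring
  | smul c t ht =>
    have := add_le_nodeCode 3 (intCode c) t.code
    rw [laTermVal, LATerm.code, treeRec, laTermStep, treeTable_length, nodeCode_fst,
      nodeCode_snd_fst, nodeCode_snd_snd, laTermClause, treeTable_getD (i := t.code) _ _ (by omega),
      LATerm.eval, ← ht]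
    conv_rhs => rw [← intVal_intCode c]
    simp [intVal, laTermVal]
    ring

/-- A bound for the codes of the integers over which a quantifier ranges. -/
def quantBound (K e : ℕ) : ℕ := (entryBound K e + 1) ^ 2

/-- A bound for the environments that arise by adding one value. -/
def pushBound (K e : ℕ) : ℕ := Nat.pair (quantBound K e) e

/-- The comparison of coded integers. -/
def IntLe (v w : ℕ) : Prop := v.unpair.1 + w.unpair.2 ≤ w.unpair.1 + v.unpair.2

theorem intLe_iff (v w : ℕ) : IntLe v w ↔ intVal v ≤ intVal w := by
  unfold IntLe intVal; omega

/-- The clauses of the definition of satisfaction; `l` lists the tables of the truth values of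
the formulas with smaller codes. -/
def LAClause (K : ℕ) (l : List (List Bool)) (e tag x y : ℕ) : Prop :=
  (tag = 0 ∧ IntLe (laTermVal e x) (laTermVal e y) ∧ IntLe (laTermVal e y) (laTermVal e x)) ∨
  (tag = 1 ∧ IntLe (laTermVal e x) (laTermVal e y)) ∨
  (tag = 2 ∧ ¬ (l.getD x []).getD e false = true) ∨
  (tag = 3 ∧ (l.getD x []).getD e false = true ∧ (l.getD y []).getD e false = true) ∨
  (tag = 4 ∧ ((l.getD x []).getD e false = true ∨ (l.getD y []).getD e false = true)) ∨
  (tag = 5 ∧ ¬ ∃ v < quantBound K e, ¬ (l.getD x []).getD (Nat.pair v e) false = true) ∨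
  (tag = 6 ∧ ∃ v < quantBound K e, (l.getD x []).getD (Nat.pair v e) false = true)

open Classical in
/-- The truth values, in the environments below `P.2`, of the formula whose code is the length of
`l`. -/
noncomputable def laStep (P : ℕ × ℕ) (l : List (List Bool)) : List Bool :=
  (List.range P.2).map fun e => decide (LAClause P.1 l e l.length.unpair.1
    l.length.unpair.2.unpair.1 l.length.unpair.2.unpair.2)

/-- Satisfaction of a coded formula of linear arithmetic. -/
def LAHolds (K e c : ℕ) : Prop :=
  (treeRec laStep (K, (pushBound K)^[c] e + 1) c).getD e false = true

namespace PR

variable {α : Type*} [Primcodable α] {f g h : α → ℕ}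

@[fun_prop] theorem envGet (hf : Primrec f) (hg : Primrec g) :
    Primrec fun a => envGet (f a) (g a) := by
  have : Primrec fun a => (fun e : ℕ => e.unpair.2)^[g a] (f a) := by
    refine iterate (F := fun _ e => e.unpair.2) ?_ hg hf
    fun_prop
  unfold WebService.envGet; fun_prop

@[fun_prop] theorem laTermVal (hf : Primrec f) (hg : Primrec g) :
    Primrec fun a => laTermVal (f a) (g a) := by
  refine treeRec ?_ hf hg
  unfold laTermStep laTermClause; fun_prop

@[fun_prop] theorem gap (hf : Primrec f) : Primrec fun a => gap (f a) := by
  unfold WebService.gap; fun_prop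

@[fun_prop] theorem entryBound (hf : Primrec f) (hg : Primrec g) :
    Primrec fun a => entryBound (f a) (g a) := by
  unfold WebService.entryBound; fun_prop

@[fun_prop] theorem quantBound (hf : Primrec f) (hg : Primrec g) :
    Primrec fun a => quantBound (f a) (g a) := by
  unfold WebService.quantBound; fun_prop

@[fun_prop] theorem laHolds (hf : Primrec f) (hg : Primrec g) (hh : Primrec h) :
    PrimrecPred fun a => LAHolds (f a) (g a) (h a) := by
  have h1 : Primrec fun a => (pushBound (f a))^[h a] (g a) := by
    refine iterate ?_ hh hg
    unfold pushBound; fun_prop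
  have h2 : Primrec fun q : (ℕ × ℕ) × List (List Bool) => laStep q.1 q.2 := by
    unfold laStep
    refine map_range (by fun_prop) ?_
    unfold LAClause IntLe
    fun_prop
  have h3 : Primrec fun a => WebService.treeRec laStep
      (f a, (pushBound (f a))^[h a] (g a) + 1) (h a) := treeRec h2 (by fun_prop) hh
  unfold LAHolds; fun_prop

end PR

theorem pair_mono {a b c d : ℕ} (h : a ≤ b) (h' : c ≤ d) : Nat.pair a c ≤ Nat.pair b d :=
  (StrictMono.monotone (fun _ _ h => Nat.pair_lt_pair_left c h) h).trans
    (StrictMono.monotone (fun _ _ h => Nat.pair_lt_pair_right b h) h')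

theorem pushBound_mono (K : ℕ) : Monotone (pushBound K) := fun _ _ h =>
  pair_mono (Nat.pow_le_pow_left (Nat.succ_le_succ (entryBound_mono le_rfl h)) 2) h

theorem le_pushBound (K e : ℕ) : e ≤ pushBound K e := Nat.right_le_pair _ _

theorem laTable_getD_iff {K E e tag x y : ℕ} (he : e < E) :
    ((treeRec laStep (K, E) (nodeCode tag x y)).getD e false = true ↔
      LAClause K (treeTable laStep (K, E) (nodeCode tag x y)) e tag x y) := by
  rw [treeRec, laStep, treeTable_length, nodeCode_fst, nodeCode_snd_fst, nodeCode_snd_snd,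
    List.getD_eq_getElem _ _ (by simpa using he), List.getElem_map, List.getElem_range]
  exact @decide_eq_true_iff _ (Classical.propDecidable _)

theorem intCode_lt_quantBound {K e : ℕ} {v : ℤ} (h : |v| ≤ entryBound K e) :
    intCode v < quantBound K e := by
  refine (Nat.pair_lt_max_add_one_sq _ _).trans_le (Nat.pow_le_pow_left ?_ 2)
  have : (v.natAbs : ℤ) ≤ entryBound K e := by rwa [Int.natCast_natAbs]
  omega

/-- The recursion has no varying parameter, so each formula gets a table of its truth values in all
environments below a fixed `E`. Quantifiers may be bounded by `exists_bounded`, as `K` dominates the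
precision of every subformula. Each quantifier enlarges the environment at most by `pushBound K`,
and the code bounds the nesting, so no lookup leaves the table. -/
theorem laTable_code {k : ℕ} (φ : LAFormula k) {K E e : ℕ} {x : Fin k → ℤ}
    (hx : ∀ i : Fin k, intVal (envGet e i) = x i) (hK : level φ.code ≤ K)
    (hE : (pushBound K)^[φ.code] e < E) :
    (treeRec laStep (K, E) φ.code).getD e false = true ↔ φ.Holds x := by
  have iter : ∀ {e c d : ℕ}, c ≤ d → (pushBound K)^[c] e ≤ (pushBound K)^[d] e := fun {e c d} h =>
    Function.monotone_iterate_of_id_le (le_pushBound K) h e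
  have htab : ∀ {c i e : ℕ}, i < c → (((treeTable laStep (K, E) c).getD i []).getD e false = true ↔
        (treeRec laStep (K, E) i).getD e false = true) := by
    intro c i e h
    rw [treeTable_getD _ _ h]
  have he : ∀ {c e : ℕ}, (pushBound K)^[c] e < E → e < E := fun {c e} h =>
    (Function.id_le_iterate_of_id_le (le_pushBound K) c e).trans_lt h
  have hle : ∀ {k e} {x : Fin k → ℤ} (s t : LATerm k), (∀ i : Fin k, intVal (envGet e i) = x i) →
      (IntLe (laTermVal e s.code) (laTermVal e t.code) ↔ s.eval x ≤ t.eval x) := by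
    intro k e x s t hx
    rw [intLe_iff, laTermVal_code e x hx, laTermVal_code e x hx]
  -- Adding a value to the environment uses up one of the iterations of `pushBound K`.
  have hpush : ∀ {c d e v : ℕ}, c + 1 ≤ d → v < quantBound K e → (pushBound K)^[d] e < E →
      (pushBound K)^[c] (Nat.pair v e) < E := by
    intro c d e v hcd hv h
    refine lt_of_le_of_lt ((pushBound_mono K).iterate c (pair_mono hv.le le_rfl)) ?_
    exact lt_of_le_of_lt (iter (c := c + 1) hcd) h
  have hcons : ∀ {k e v} {x : Fin k → ℤ}, (∀ i : Fin k, intVal (envGet e i) = x i) →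
      ∀ i : Fin (k + 1), intVal (envGet (Nat.pair v e) i) = (Fin.cons (intVal v) x :
        Fin (k + 1) → ℤ) i := by
    intro k e v x hx i
    cases i using Fin.cases with
    | zero => simp
    | succ i => simp [hx]
  have hsum : ∀ {k e} {x : Fin k → ℤ}, (∀ i : Fin k, intVal (envGet e i) = x i) →
      ∑ i, (x i).natAbs ≤ e := by
    intro k e x hx
    simpa only [hx] using sum_envGet_le k e
  have hbound : ∀ {k e} {x : Fin k → ℤ} (φ : LAFormula (k + 1)) (u : ℤ),
      (∀ i : Fin k, intVal (envGet e i) = x i) → level φ.code ≤ K →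
      ∃ v < quantBound K e, (φ.Holds (Fin.cons u x) ↔ φ.Holds (Fin.cons (intVal v) x)) := by
    intro k e x φ u hx hK
    obtain ⟨v, hv, h⟩ := φ.exists_bounded x u
    refine ⟨intCode v, intCode_lt_quantBound (hv.trans ?_), by rwa [intVal_intCode]⟩
    exact_mod_cast entryBound_mono hK (hsum hx)
  induction φ generalizing e with
  | eq s t =>
    rw [LAFormula.code, laTable_getD_iff (he hE), LAClause, hle s t hx, hle t s hx]
    simp only [OfNat.zero_ne_ofNat, zero_ne_one, true_and, false_and, or_false, LAFormula.Holds]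
    exact le_antisymm_iff.symm
  | le s t =>
    rw [LAFormula.code, laTable_getD_iff (he hE), LAClause, hle s t hx, hle t s hx]
    simp [LAFormula.Holds]
  | not φ ih =>
    have h0 := add_le_nodeCode 2 φ.code 0
    rw [LAFormula.code] at hE hK
    rw [LAFormula.code, laTable_getD_iff (he hE), LAClause, htab (by omega)]
    have h1 := ih hx ((level_mono (by omega)).trans hK) ((iter (by omega)).trans_lt hE)
    simp only [h1]
    simp [LAFormula.Holds]
  | and φ ψ ih ih' =>
    have h0 := add_le_nodeCode 3 φ.code ψ.code
    rw [LAFormula.code] at hE hK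
    rw [LAFormula.code, laTable_getD_iff (he hE), LAClause, htab (by omega), htab (by omega)]
    have h1 := ih hx ((level_mono (by omega)).trans hK) ((iter (by omega)).trans_lt hE)
    have h2 := ih' hx ((level_mono (by omega)).trans hK) ((iter (by omega)).trans_lt hE)
    simp only [h1, h2]
    simp [LAFormula.Holds]
  | or φ ψ ih ih' =>
    have h0 := add_le_nodeCode 4 φ.code ψ.code
    rw [LAFormula.code] at hE hK
    rw [LAFormula.code, laTable_getD_iff (he hE), LAClause, htab (by omega), htab (by omega)]
    have h1 := ih hx ((level_mono (by omega)).trans hK) ((iter (by omega)).trans_lt hE)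
    have h2 := ih' hx ((level_mono (by omega)).trans hK) ((iter (by omega)).trans_lt hE)
    simp only [h1, h2]
    simp [LAFormula.Holds]
  | all φ ih =>
    have h0 := add_le_nodeCode 5 φ.code 0
    rw [LAFormula.code] at hE hK
    have hK' : level φ.code ≤ K := (level_mono (by omega)).trans hK
    have hv : ∀ {v}, v < quantBound K e →
        (((treeTable laStep (K, E) (nodeCode 5 φ.code 0)).getD φ.code []).getD
          (Nat.pair v e) false = true ↔ φ.Holds (Fin.cons (intVal v) x)) := fun {v} h =>
      (htab (by omega)).trans (ih (hcons hx) hK' (hpush (by omega) h hE))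
    rw [LAFormula.code, laTable_getD_iff (he hE), LAClause]
    simp only [show (5 : ℕ) ≠ 0 by norm_num, show (5 : ℕ) ≠ 1 by norm_num,
      show (5 : ℕ) ≠ 2 by norm_num, show (5 : ℕ) ≠ 3 by norm_num, show (5 : ℕ) ≠ 4 by norm_num,
      show (5 : ℕ) ≠ 6 by norm_num, false_and, false_or, or_false, true_and, LAFormula.Holds]
    constructor
    · intro H u
      obtain ⟨v, hvb, hiff⟩ := hbound φ u hx hK'
      rw [hiff, ← hv hvb]
      by_contra hne
      exact H ⟨v, hvb, hne⟩
    · rintro H ⟨v, hvb, hne⟩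
      exact hne ((hv hvb).2 (H _))
  | ex φ ih =>
    have h0 := add_le_nodeCode 6 φ.code 0
    rw [LAFormula.code] at hE hK
    have hK' : level φ.code ≤ K := (level_mono (by omega)).trans hK
    have hv : ∀ {v}, v < quantBound K e →
        (((treeTable laStep (K, E) (nodeCode 6 φ.code 0)).getD φ.code []).getD
          (Nat.pair v e) false = true ↔ φ.Holds (Fin.cons (intVal v) x)) := fun {v} h =>
      (htab (by omega)).trans (ih (hcons hx) hK' (hpush (by omega) h hE))
    rw [LAFormula.code, laTable_getD_iff (he hE), LAClause]
    simp only [show (6 : ℕ) ≠ 0 by norm_num, show (6 : ℕ) ≠ 1 by norm_num,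
      show (6 : ℕ) ≠ 2 by norm_num, show (6 : ℕ) ≠ 3 by norm_num, show (6 : ℕ) ≠ 4 by norm_num,
      show (6 : ℕ) ≠ 5 by norm_num, false_and, false_or, true_and, LAFormula.Holds]
    constructor
    · rintro ⟨v, hvb, h⟩
      exact ⟨_, (hv hvb).1 h⟩
    · rintro ⟨u, hu⟩
      obtain ⟨v, hvb, hiff⟩ := hbound φ u hx hK'
      exact ⟨v, hvb, (hv hvb).2 (hiff.1 hu)⟩

theorem laHolds_code {k : ℕ} (φ : LAFormula k) {e : ℕ} {x : Fin k → ℤ}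
    (hx : ∀ i : Fin k, intVal (envGet e i) = x i) :
    LAHolds (level φ.code) e φ.code ↔ φ.Holds x :=
  laTable_code φ hx le_rfl (Nat.lt_succ_self _)

/-! ### Coded systems -/

/-- Comparison with a coded atom of an initial condition. -/
def CmpHolds (e x : ℕ) : Prop :=
  (e.unpair.1 = 0 ∧ x = e.unpair.2) ∨ (e.unpair.1 = 1 ∧ x ≠ e.unpair.2) ∨
  (e.unpair.1 = 2 ∧ e.unpair.2 < x) ∨ (e.unpair.1 = 3 ∧ e.unpair.2 ≤ x)

/-- A coded change of a variable. -/
def ChangeHolds (e x x' : ℕ) : Prop :=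
  (e = 0 ∧ x' = x + 1) ∨ (e = 1 ∧ x' + 1 = x) ∨ (e = 2 ∧ x' = x)

/-- The initial condition of the vector addition system with code `V`, for the marking with
digits `μ` in base `b`. -/
def VASInit (V b μ : ℕ) : Prop :=
  ∀ p < V.unpair.1.unpair.1, CmpHolds (entry V.unpair.2.unpair.1 p) (digit b μ p)

/-- The formula of a coded transition of a vector addition system. -/
def VASStep (τ m b μ μ' : ℕ) : Prop :=
  ∀ p < m, (entry τ.unpair.1 p ≠ 1 ∨ 1 ≤ digit b μ p) ∧
    ChangeHolds (entry τ.unpair.2 p) (digit b μ p) (digit b μ' p)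

/-- The initial condition of a coded RBAC4BPEL system. -/
def RBACInit (R X : ℕ) : Prop :=
  ∀ w < assignmentBound R.unpair.1 R.unpair.2.unpair.1.unpair.1,
    QFHolds (R.unpair.1, X, 0, 0, w) R.unpair.2.unpair.1.unpair.2

/-- The formula of a coded transition of an RBAC4BPEL system. -/
def RBACStep (A τ X X' : ℕ) : Prop :=
  ∃ w < assignmentBound A τ.unpair.1.unpair.1,
    QFHolds (A, X, 0, 0, w) τ.unpair.1.unpair.2 ∧
    ∀ u < sortEntry A.unpair.1 0, ∀ y < sortEntry A.unpair.1 3,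
      (XcdBit A X' u y ↔
        (u = varVal (A, X, 0, 0, w) 0 τ.unpair.2.unpair.1 ∧ y = τ.unpair.2.unpair.2) ∨
          XcdBit A X u y)

/-- Satisfaction of a coded BSR formula. -/
def BSRHolds (A G X : ℕ) : Prop :=
  ∃ z < assignmentBound A G.unpair.1.unpair.1, ∀ w < assignmentBound A G.unpair.1.unpair.2,
    QFHolds (A, X, G.unpair.1.unpair.1, z, w) G.unpair.2

/-- The environment that lists the last `k` of the `m` entries of a marking. -/
def markingEnv (b μ m : ℕ) : ℕ → ℕ
  | 0 => 0
  | k + 1 => Nat.pair (Nat.pair (digit b μ (m - (k + 1))) 0) (markingEnv b μ m k)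

/-- The initial condition of a coded system. A state is coded by the digits of the marking and
those of `xcd`. -/
def StateInit (a b q : ℕ) : Prop :=
  VASInit a.unpair.1.unpair.1 b q.unpair.1 ∧ RBACInit a.unpair.1.unpair.2 q.unpair.2

/-- The transition relation of a coded system. -/
def StateStep (a b q q' : ℕ) : Prop :=
  ∃ t < a.unpair.1.unpair.1.unpair.1.unpair.2,
    VASStep (entry a.unpair.1.unpair.1.unpair.2.unpair.2 t)
      a.unpair.1.unpair.1.unpair.1.unpair.1 b q.unpair.1 q'.unpair.1 ∧
    RBACStep a.unpair.1.unpair.2.unpair.1 (entry a.unpair.1.unpair.2.unpair.2.unpair.2 t)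
      q.unpair.2 q'.unpair.2

/-- The goal of a coded instance. -/
def StateGoal (a b q : ℕ) : Prop :=
  LAHolds (level a.unpair.2.unpair.1) (markingEnv b q.unpair.1
    a.unpair.1.unpair.1.unpair.1.unpair.1 a.unpair.1.unpair.1.unpair.1.unpair.1)
      a.unpair.2.unpair.1 ∧
  BSRHolds a.unpair.1.unpair.2.unpair.1 a.unpair.2.unpair.2 q.unpair.2

/-- The length of the run and the size of the initial marking of a run to a goal of precision `L`
that can be found if there is one; `d` is the number of truth values of `xcd`. -/
def searchBound (m n d L : ℕ) : ℕ :=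
  (blockGrowth m n (gap^[m] ((blockLevel m n)^[d + 1] L)))^[d + 1]
    ((growth (gap^[m] ((blockLevel m n)^[d + 1] L)))^[m] 0)

/-- The number of truth values of `xcd` in a coded instance. -/
def xcdSize (a : ℕ) : ℕ :=
  sortEntry a.unpair.1.unpair.2.unpair.1.unpair.1 0 *
    sortEntry a.unpair.1.unpair.2.unpair.1.unpair.1 3

/-- The search bound of a coded instance. -/
def runBound (a : ℕ) : ℕ :=
  searchBound a.unpair.1.unpair.1.unpair.1.unpair.1 a.unpair.1.unpair.1.unpair.1.unpair.2
    (xcdSize a) (level a)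

/-- A bound for the codes of the states of the runs that are searched. -/
def stateBound (a : ℕ) : ℕ :=
  Nat.pair ((runBound a + 1) ^ a.unpair.1.unpair.1.unpair.1.unpair.1) (2 ^ xcdSize a) + 1

/-- There is a bounded run, given by the digits of `r`, to the goal. -/
def Accepts (a : ℕ) : Prop :=
  ∃ ℓ < runBound a + 1, ∃ r < stateBound a ^ (ℓ + 1),
    StateInit a (runBound a + 1) (digit (stateBound a) r 0) ∧
    (∀ i < ℓ, StateStep a (runBound a + 1) (digit (stateBound a) r i)
      (digit (stateBound a) r (i + 1))) ∧
    StateGoal a (runBound a + 1) (digit (stateBound a) r ℓ)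

/-! ### Primitive recursiveness of the search -/

namespace PR

variable {α : Type*} [Primcodable α] {f g h k l : α → ℕ}

@[fun_prop] theorem assignmentBound (hf : Primrec f) (hg : Primrec g) :
    Primrec fun a => assignmentBound (f a) (g a) := by
  unfold WebService.assignmentBound; fun_prop

@[fun_prop] theorem vasInit (hf : Primrec f) (hg : Primrec g) (hh : Primrec h) :
    PrimrecPred fun a => VASInit (f a) (g a) (h a) := by
  unfold VASInit CmpHolds
  exact forall_lt (by fun_prop) (by fun_prop)

@[fun_prop] theorem vasStep (hf : Primrec f) (hg : Primrec g) (hh : Primrec h) (hk : Primrec k)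
    (hl : Primrec l) : PrimrecPred fun a => VASStep (f a) (g a) (h a) (k a) (l a) := by
  unfold VASStep ChangeHolds
  exact forall_lt (by fun_prop) (by fun_prop)

@[fun_prop] theorem rbacInit (hf : Primrec f) (hg : Primrec g) :
    PrimrecPred fun a => RBACInit (f a) (g a) := by
  unfold RBACInit
  exact forall_lt (by fun_prop) (by fun_prop)

@[fun_prop] theorem rbacStep (hf : Primrec f) (hg : Primrec g) (hh : Primrec h)
    (hk : Primrec k) : PrimrecPred fun a => RBACStep (f a) (g a) (h a) (k a) := by
  unfold RBACStep
  refine exists_lt (by fun_prop) (and (by fun_prop) ?_)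
  refine forall_lt (by fun_prop) (forall_lt (by fun_prop) (by fun_prop))

@[fun_prop] theorem bsrHolds (hf : Primrec f) (hg : Primrec g) (hh : Primrec h) :
    PrimrecPred fun a => BSRHolds (f a) (g a) (h a) := by
  unfold BSRHolds
  exact exists_lt (by fun_prop) (forall_lt (by fun_prop) (by fun_prop))

@[fun_prop] theorem markingEnv (hf : Primrec f) (hg : Primrec g) (hh : Primrec h)
    (hk : Primrec k) : Primrec fun a => markingEnv (f a) (g a) (h a) (k a) := by
  refine (Primrec.nat_rec' (f := k) (g := fun _ => 0)
    (h := fun a q => Nat.pair (Nat.pair (WebService.digit (f a) (g a) (h a - (q.1 + 1))) 0) q.2)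
    hk (Primrec.const _) ?_).of_eq fun a => ?_
  · show Primrec fun q : α × ℕ × ℕ => Nat.pair (Nat.pair
      (WebService.digit (f q.1) (g q.1) (h q.1 - (q.2.1 + 1))) 0) q.2.2
    fun_prop
  · induction k a with
    | zero => rfl
    | succ k ih => rw [WebService.markingEnv, ← ih]

@[fun_prop] theorem iterate_gap (hf : Primrec f) (hg : Primrec g) :
    Primrec fun a => WebService.gap^[f a] (g a) :=
  iterate (F := fun _ => WebService.gap) (by fun_prop) hf hg

@[fun_prop] theorem level (hf : Primrec f) : Primrec fun a => level (f a) := by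
  unfold WebService.level; fun_prop

@[fun_prop] theorem iterate_growth (hf : Primrec f) (hg : Primrec g) (hh : Primrec h) :
    Primrec fun a => (growth (f a))^[g a] (h a) := by
  refine iterate ?_ hg hh
  unfold growth; fun_prop

@[fun_prop] theorem searchBound (hf : Primrec f) (hg : Primrec g) (hh : Primrec h)
    (hk : Primrec k) : Primrec fun a => searchBound (f a) (g a) (h a) (k a) := by
  have h1 : Primrec fun a => (blockLevel (f a) (g a))^[h a + 1] (k a) := by
    refine iterate ?_ (by fun_prop) hk
    unfold blockLevel; fun_prop
  have h2 : ∀ K : α → ℕ, Primrec K → Primrec fun a =>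
      (blockGrowth (f a) (g a) (K a))^[h a + 1] ((growth (K a))^[f a] 0) := by
    intro K hK
    refine iterate ?_ (by fun_prop) (by fun_prop)
    unfold blockGrowth; fun_prop
  exact h2 _ (iterate_gap hf h1)

@[fun_prop] theorem runBound (hf : Primrec f) : Primrec fun a => runBound (f a) := by
  unfold WebService.runBound xcdSize; fun_prop

@[fun_prop] theorem stateBound (hf : Primrec f) : Primrec fun a => stateBound (f a) := by
  unfold WebService.stateBound xcdSize; fun_prop

theorem accepts : PrimrecPred Accepts := by
  unfold Accepts
  refine exists_lt (by fun_prop) (exists_lt (by fun_prop) (and ?_ (and ?_ ?_)))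
  · unfold StateInit; fun_prop
  · refine forall_lt (by fun_prop) ?_
    unfold StateStep; fun_prop
  · unfold StateGoal; fun_prop

end PR

/-! ### Correctness -/

theorem cmpHolds_code (c : Cmp × ℕ) (x : ℕ) :
    CmpHolds (Nat.pair c.1.code c.2) x ↔ c.1.Holds x c.2 := by
  obtain ⟨c, k⟩ := c
  cases c <;> simp [CmpHolds, Cmp.code, Cmp.Holds]

theorem changeHolds_code (c : Change) (x x' : ℕ) :
    ChangeHolds c.code x x' ↔ c.Holds x x' := by
  cases c <;> simp [ChangeHolds, Change.code, Change.Holds] <;> omega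

theorem vasInit_code {m n : ℕ} (V : VAS m n) (b μ : ℕ) :
    VASInit V.code b μ ↔ V.Init fun p => digit b μ p := by
  simp only [VASInit, VAS.code, Nat.unpair_pair]
  constructor
  · intro h p
    simpa only [entry_seqCode, cmpHolds_code] using h p p.2
  · intro h p hp
    have := h ⟨p, hp⟩
    rw [← cmpHolds_code] at this
    rwa [← entry_seqCode (fun i => Nat.pair (V.init i).1.code (V.init i).2)] at this

theorem vasStep_code {m : ℕ} (τ : VASTransition m) (b μ μ' : ℕ) :
    VASStep τ.code m b μ μ' ↔ τ.Holds (fun p => digit b μ p) fun p => digit b μ' p := by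
  have key : ∀ p : Fin m, ((entry τ.code.unpair.1 p ≠ 1 ∨ 1 ≤ digit b μ p) ∧
      ChangeHolds (entry τ.code.unpair.2 p) (digit b μ p) (digit b μ' p)) ↔
      ((τ.guard p = true → 1 ≤ digit b μ p) ∧
        (τ.change p).Holds (digit b μ p) (digit b μ' p)) := by
    intro p
    simp only [VASTransition.code, Nat.unpair_pair, entry_seqCode, changeHolds_code]
    cases τ.guard p <;> simp
  unfold VASStep VASTransition.Holds
  rw [← forall_and]
  exact ⟨fun h p => (key p).1 (h p p.2), fun h p hp => (key ⟨p, hp⟩).2 (h ⟨p, hp⟩)⟩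

theorem rbacInit_code {n : ℕ} (R : RBACSystem n) (X : ℕ) :
    RBACInit R.code X ↔ R.Init (R.str.toXcd X) := by
  simp only [RBACInit, RBACSystem.code, Nat.unpair_pair, RBACSystem.Init, qfHolds_toAssignment]
  refine ⟨fun h ρ => ?_, fun h w _ => h _⟩
  obtain ⟨w, hw, rfl⟩ := R.str.exists_toAssignment R.initVars ρ
  exact h w hw

theorem rbacStep_code (A : RBACStructure) (τ : RBACTransition A.size) (X X' : ℕ) :
    RBACStep A.code τ.code X X' ↔ τ.Holds A (A.toXcd X) (A.toXcd X') := by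
  have hsize : ∀ s : Srt, sortEntry A.code.unpair.1 s.code = A.size s := A.sortEntry_code
  have hu := hsize .user
  have ha := hsize .action
  have key : ∀ w, (∀ u < sortEntry A.code.unpair.1 0, ∀ y < sortEntry A.code.unpair.1 3,
      (XcdBit A.code X' u y ↔
        (u = varVal (A.code, X, 0, 0, w) 0 τ.performer ∧ y = τ.act) ∨ XcdBit A.code X u y)) ↔
      ∀ x y, A.toXcd X' x y ↔ ((x = A.toAssignment τ.vars w .user τ.performer ∧ y = τ.act) ∨
        A.toXcd X x y) := by
    intro w
    have hv : varVal (A.code, X, 0, 0, w) 0 τ.performer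
        = A.toAssignment τ.vars w .user τ.performer := by
      have h0 : sortEntry 0 0 = 0 := rfl
      simp only [Srt.code] at hu
      simp [varVal, h0, hu, RBACStructure.toAssignment, Srt.code]
    simp only [Srt.code] at hu ha
    rw [hu, ha, hv]
    simp only [RBACStructure.toXcd, Fin.ext_iff]
    exact ⟨fun h u y => h u u.2 y y.2, fun h u hu y hy => h ⟨u, hu⟩ ⟨y, hy⟩⟩
  simp only [RBACStep, RBACTransition.code, Nat.unpair_pair, RBACTransition.Holds,
    qfHolds_toAssignment, key]
  constructor
  · rintro ⟨w, -, h⟩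
    exact ⟨_, h⟩
  · rintro ⟨ρ, h⟩
    obtain ⟨w, hw, rfl⟩ := A.exists_toAssignment τ.vars ρ
    exact ⟨w, hw, h⟩

theorem bsrHolds_code (A : RBACStructure) (G : BSRFormula A.size) (X : ℕ) :
    BSRHolds A.code G.code X ↔ G.Holds A (A.toXcd X) := by
  simp only [BSRHolds, BSRFormula.code, Nat.unpair_pair, BSRFormula.Holds, qfHolds_append]
  constructor
  · rintro ⟨z, -, h⟩
    refine ⟨A.toAssignment G.exVars z, fun ρ => ?_⟩
    obtain ⟨w, hw, rfl⟩ := A.exists_toAssignment G.allVars ρ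
    exact h w hw
  · rintro ⟨ρ, h⟩
    obtain ⟨z, hz, rfl⟩ := A.exists_toAssignment G.exVars ρ
    exact ⟨z, hz, fun w _ => h _⟩

theorem envGet_markingEnv {b μ m k i : ℕ} (hk : k ≤ m) (hi : i < k) :
    envGet (markingEnv b μ m k) i = Nat.pair (digit b μ (m - k + i)) 0 := by
  induction k generalizing i with
  | zero => omega
  | succ k ih =>
    rw [markingEnv]
    cases i with
    | zero => simp
    | succ i =>
      rw [envGet_pair_succ, ih (by omega) (by omega), show m - k + i = m - (k + 1) + (i + 1) by omega]

/-! ### Soundness and completeness of the search for whole systems -/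

namespace VASRBACSystem

variable {m n : ℕ} (S : VASRBACSystem m n) (GV : LAFormula m) (GR : BSRFormula S.rbac.str.size)

/-- The state with a given code. -/
def toState (b q : ℕ) : (Fin m → ℕ) × S.rbac.str.Xcd :=
  (fun p => digit b q.unpair.1 p, S.rbac.str.toXcd q.unpair.2)

theorem stateInit_code (b q : ℕ) :
    StateInit (S.instanceCode GV GR) b q ↔ S.toTwoLevel.init (S.toState b q) := by
  simp only [StateInit, instanceCode, Nat.unpair_pair, vasInit_code, rbacInit_code]
  rfl

theorem stateStep_code (b q q' : ℕ) :
    StateStep (S.instanceCode GV GR) b q q' ↔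
      ∃ j, S.toTwoLevel.trans j (S.toState b q) (S.toState b q') := by
  have h1 : S.vas.code.unpair.1 = Nat.pair m n := by simp [VAS.code]
  have h2 : S.vas.code.unpair.2.unpair.2 = seqCode fun t => (S.vas.trans t).code := by
    simp [VAS.code]
  have h3 : S.rbac.code.unpair.1 = S.rbac.str.code := by simp [RBACSystem.code]
  have h4 : S.rbac.code.unpair.2.unpair.2 = seqCode fun t => (S.rbac.trans t).code := by
    simp [RBACSystem.code]
  have key : ∀ t : Fin n, VASStep (entry (seqCode fun t => (S.vas.trans t).code) t) m b
      q.unpair.1 q'.unpair.1 ∧ RBACStep S.rbac.str.code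
        (entry (seqCode fun t => (S.rbac.trans t).code) t) q.unpair.2 q'.unpair.2 ↔
      S.toTwoLevel.trans t (S.toState b q) (S.toState b q') := by
    intro t
    simp only [entry_seqCode, vasStep_code, rbacStep_code]
    rfl
  simp only [StateStep, instanceCode, Nat.unpair_pair, h1, h2, h3, h4]
  constructor
  · rintro ⟨t, ht, h⟩
    exact ⟨⟨t, ht⟩, (key ⟨t, ht⟩).1 h⟩
  · rintro ⟨t, h⟩
    exact ⟨t, t.2, (key t).2 h⟩

theorem stateGoal_code (b q : ℕ) :
    StateGoal (S.instanceCode GV GR) b q ↔ S.goal GV GR (S.toState b q) := by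
  have h1 : S.vas.code.unpair.1 = Nat.pair m n := by simp [VAS.code]
  have h3 : S.rbac.code.unpair.1 = S.rbac.str.code := by simp [RBACSystem.code]
  simp only [StateGoal, instanceCode, Nat.unpair_pair, h1, h3, bsrHolds_code]
  refine and_congr (laHolds_code GV fun i => ?_) Iff.rfl
  rw [envGet_markingEnv le_rfl i.2]
  simp [intVal, toState]

theorem xcdSize_code : xcdSize (S.instanceCode GV GR) =
    S.rbac.str.size .user * S.rbac.str.size .action := by
  have hu := S.rbac.str.sortEntry_code .user
  have ha := S.rbac.str.sortEntry_code .action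
  simp only [Srt.code] at hu ha
  simp [xcdSize, instanceCode, RBACSystem.code, hu, ha]

theorem runBound_code : runBound (S.instanceCode GV GR) =
    searchBound m n (S.rbac.str.size .user * S.rbac.str.size .action)
      (level (S.instanceCode GV GR)) := by
  rw [runBound, xcdSize_code]
  simp [instanceCode, VAS.code]

theorem stateBound_code : stateBound (S.instanceCode GV GR) =
    Nat.pair ((runBound (S.instanceCode GV GR) + 1) ^ m)
      (2 ^ (S.rbac.str.size .user * S.rbac.str.size .action)) + 1 := by
  have h : (S.instanceCode GV GR).unpair.1.unpair.1.unpair.1.unpair.1 = m := by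
    simp [instanceCode, VAS.code]
  rw [stateBound, xcdSize_code, h]

theorem goalReachable_iff_stepsTo {G : (Fin m → ℕ) × S.rbac.str.Xcd → Prop} :
    S.toTwoLevel.GoalReachable G ↔ ∃ ℓ s, S.toTwoLevel.init s ∧
      StepsTo (fun v v' => ∃ j, S.toTwoLevel.trans j v v') G ℓ s := by
  simp only [stepsTo_iff]
  constructor
  · rintro ⟨ℓ, v, h0, hs, hG⟩
    refine ⟨ℓ, _, h0, fun i => if h : i < ℓ + 1 then v ⟨i, h⟩ else v 0, by simp,
      fun i hi => ?_, ?_⟩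
    · beta_reduce
      rw [dif_pos (by omega), dif_pos (by omega)]
      exact hs ⟨i, hi⟩
    · beta_reduce
      rw [dif_pos (by omega)]
      exact hG
  · rintro ⟨ℓ, s, h0, v, rfl, hs, hG⟩
    exact ⟨ℓ, fun i => v i, h0, fun i => hs i i.2, hG⟩

open Classical in
/-- The number of pairs at which `xcd` is false. -/
noncomputable def missing (X : S.rbac.str.Xcd) : ℕ := #{q : Fin _ × Fin _ | ¬ X q.1 q.2}

theorem missing_le (X : S.rbac.str.Xcd) :
    S.missing X ≤ S.rbac.str.size .user * S.rbac.str.size .action :=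
  (Finset.card_le_univ _).trans (by simp)

/-- A transition never removes a pair from `xcd`, so if `xcd` changes, the set of missing pairs
shrinks strictly. This is the rank that bounds the number of blocks. -/
theorem missing_lt (t : Fin n) (X X' : S.rbac.str.Xcd)
    (h : (S.rbac.trans t).Holds S.rbac.str X X') : X' = X ∨ S.missing X' < S.missing X := by
  classical
  obtain ⟨ρ, -, h⟩ := h
  refine or_iff_not_imp_left.2 fun hne => Finset.card_lt_card ?_
  rw [Finset.ssubset_iff_of_subset]
  · by_contra hall
    push Not at hall
    refine hne (funext fun u => funext fun y => propext ⟨fun hX' => ?_, fun hX => ?_⟩)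
    · by_contra hX
      have := hall (u, y) (by simpa using hX)
      simp only [Finset.mem_filter, Finset.mem_univ, true_and] at this
      exact this hX'
    · exact (h u y).2 (.inr hX)
  · intro q hq
    simp only [Finset.mem_filter, Finset.mem_univ, true_and] at hq ⊢
    exact fun hX => hq ((h _ _).2 (.inr hX))

/-- Any coded run found by the search decodes to a run; neither the bounds nor acyclicity matter
here. -/
theorem goalReachable_of_accepts (h : Accepts (S.instanceCode GV GR)) :
    S.toTwoLevel.GoalReachable (S.goal GV GR) := by
  obtain ⟨ℓ, -, r, -, h0, hs, hG⟩ := h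
  rw [goalReachable_iff_stepsTo]
  refine ⟨ℓ, _, (S.stateInit_code GV GR _ _).1 h0, (stepsTo_iff _ _ _ _).2
    ⟨fun i => S.toState _ (digit _ r i), rfl, fun i hi => (S.stateStep_code GV GR _ _ _).1 (hs i hi),
      (S.stateGoal_code GV GR _ _).1 hG⟩⟩

/-- The precision `level` of the whole instance code therefore serves for the initial condition and
for the goal at once. -/
theorem const_le_instanceCode (p : Fin m) : (S.vas.init p).2 ≤ S.instanceCode GV GR := by
  refine (Nat.right_le_pair (S.vas.init p).1.code _).trans ?_
  refine (le_seqCode (fun i => Nat.pair (S.vas.init i).1.code (S.vas.init i).2) p).trans ?_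
  have h : S.vas.code ≤ S.instanceCode GV GR :=
    (Nat.left_le_pair _ _).trans (Nat.left_le_pair _ _)
  refine le_trans ?_ h
  rw [VAS.code]
  exact (Nat.left_le_pair _ _).trans (Nat.right_le_pair _ _)

theorem code_goal_le_instanceCode : GV.code ≤ S.instanceCode GV GR :=
  (Nat.left_le_pair _ _).trans (Nat.right_le_pair _ _)

theorem lt_level (c : ℕ) : c + 1 < level c :=
  Nat.lt_two_pow_self.trans_le (two_pow_le_level c)

/-- Each comparison with `c` is determined by the truth of `c ≤ x` and `c + 1 ≤ x`. -/
theorem init_congr {x y : Fin m → ℕ} {c : ℕ} (hc : ∀ p, (S.vas.init p).2 ≤ c)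
    (h : FormEquiv (level c) univ (fun p => (x p : ℤ)) (fun p => (y p : ℤ)))
    (hx : S.vas.Init x) : S.vas.Init y := by
  intro p
  have hl := lt_level c
  have h1 := h.le_iff (mem_univ p) (by omega) (k := (S.vas.init p).2) (by
    have := hc p
    rw [Nat.abs_cast]; exact_mod_cast (by omega))
  have h2 := h.le_iff (mem_univ p) (by omega) (k := ((S.vas.init p).2 + 1 : ℕ)) (by
    have := hc p
    rw [Nat.abs_cast]; exact_mod_cast (by omega))
  have hp := hx p
  revert hp
  generalize (S.vas.init p).1 = r
  cases r <;> simp only [Cmp.Holds] <;> omega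

theorem accepts_of_goalReachable {N : PetriNet m n} (hN : N.Acyclic)
    (hS : S.vas.IsAssociatedWith N) (h : S.toTwoLevel.GoalReachable (S.goal GV GR)) :
    Accepts (S.instanceCode GV GR) := by
  rw [goalReachable_iff_stepsTo] at h
  obtain ⟨ℓ, ⟨x, X⟩, hinit, hrun⟩ := h
  have hstep : (fun v v' => ∃ j, S.toTwoLevel.trans j v v') =
      N.Step fun t => (S.rbac.trans t).Holds S.rbac.str := by
    funext v v'
    refine propext (exists_congr fun j => ?_)
    rw [← hS j]
    rfl
  rw [hstep] at hrun
  set a := S.instanceCode GV GR with ha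
  obtain ⟨ℓ', y, hbound, hy, hrun'⟩ := hN.exists_bounded_run_of_init (rank := S.missing)
    (fun t X X' => S.missing_lt t X X') (L := level a) (K := _) (I := S.vas.Init)
    (by have := lt_level a; omega)
    (fun X x y he hG => ⟨(GV.holds_iff (he.mono (level_mono
      (S.code_goal_le_instanceCode GV GR)))).1 hG.1, hG.2⟩)
    (fun x y he => S.init_congr (S.const_le_instanceCode GV GR) he)
    (S.missing_le X) le_rfl hinit.1 hrun
  change ℓ' + ∑ p, y p ≤ searchBound m n _ _ at hbound
  rw [← runBound_code S GV GR, ← ha] at hbound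
  rw [← hstep, stepsTo_iff] at hrun'
  obtain ⟨v, hv0, hv, hG⟩ := hrun'
  -- Each step adds at most one token to a place, so the search bound limits every entry along the
  -- run, and digits in base `runBound a + 1` suffice.
  have hmark : ∀ i ≤ ℓ', ∀ p, (v i).1 p ≤ ∑ p, y p + i := by
    intro i hi
    induction i with
    | zero => intro p; rw [hv0]; exact Finset.single_le_sum (f := y) (by simp) (mem_univ p)
    | succ i ih =>
      intro p
      obtain ⟨j, hj, -⟩ := hv i hi
      have hj' := hj.2 p
      rw [hS j] at hj
      have h1 := (((N.vasTransition_holds_iff j _ _).1 hj).2 p)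
      have h2 := (abs_le.1 (N.abs_effect_le j p)).2
      have h3 := ih (by omega) p
      omega
  have hcode : ∀ i, i < ℓ' + 1 → ∃ q < stateBound a, S.toState (runBound a + 1) q = v i := by
    intro i hi
    obtain ⟨μ, hμ, h1⟩ := exists_digits (b := runBound a + 1) m
      (fun p => if h : p < m then (v i).1 ⟨p, h⟩ else 0) (fun p hp => by
        have := hmark i (by omega) ⟨p, hp⟩
        simp only [dif_pos hp]
        omega)
    obtain ⟨c, hc, h2⟩ := S.rbac.str.exists_toXcd (v i).2
    refine ⟨Nat.pair μ c, ?_, ?_⟩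
    · rw [stateBound_code]
      exact Nat.lt_succ_of_le (pair_mono hμ.le hc.le)
    · refine Prod.ext (funext fun p => ?_) (by simpa [toState] using h2)
      simp [toState, h1 p p.2]
  choose! q hq hqv using hcode
  obtain ⟨r, hr, hd⟩ := exists_digits (b := stateBound a) (ℓ' + 1) q fun i hi => hq i hi
  refine ⟨ℓ', by omega, r, hr, ?_, fun i hi => ?_, ?_⟩
  · rw [ha, stateInit_code, ← ha, hd 0 (by omega), hqv 0 (by omega), hv0]
    exact ⟨hy, hinit.2⟩
  · rw [ha, stateStep_code, ← ha, hd i (by omega), hd (i + 1) (by omega), hqv i (by omega),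
      hqv (i + 1) (by omega)]
    exact hv i hi
  · rw [ha, stateGoal_code, ← ha, hd ℓ' (by omega), hqv ℓ' (by omega)]
    exact hG

end VASRBACSystem

end WebService

theorem theorem1 :
    ∃ alg : ℕ → Bool, Computable alg ∧
      ∀ (m n : ℕ) (N : WebService.PetriNet m n) (S : WebService.VASRBACSystem m n)
        (GV : WebService.LAFormula m) (GR : WebService.BSRFormula S.rbac.str.size),
        N.IsWorkflowNet → N.Acyclic → S.vas.IsAssociatedWith N →
          (alg (S.instanceCode GV GR) = true ↔
            S.toTwoLevel.GoalReachable (S.goal GV GR)) := by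
  classical
  -- The decidability instance is classical; computability comes from `PR.accepts`.
  refine ⟨fun a => decide (WebService.Accepts a), WebService.PR.accepts.decide.to_comp,
    fun m n N S GV GR _ hN hS => ?_⟩
  rw [decide_eq_true_iff]
  exact ⟨S.goalReachable_of_accepts GV GR, S.accepts_of_goalReachable GV GR hN hS⟩
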